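/- **Definitions.** An *infinite matrix* is an element $A=\|A_{ij}\|_{i,j\in\mathbb N}$ of $\mathbb R^{\mathbb N\times\mathbb N}$ with the product Borel $\sigma$-algebra. Throughout, $(\xi_i),(\eta_j),(\lambda_{ij})$ are independent random variables, uniformly distributed on $[0,1]$. *Aldous measure with zero $\lambda$:* a probability measure $M$ on infinite matrices that is invariant and ergodic under all pairs (permutation of the rows, permutation of the columns), and is the law of $\|F(\xi_i,\eta_j,\lambda_{ij})\|_{i,j}$ for some measurable $F:[0,1]^3\to\mathbb R$ that does not depend on its last variable mod 0: for a.e. $(x,y)$ the function $F(x,y,\cdot)$ is a.e. constant. *Symmetric Aldous measure with zero $\lambda$:* a probability measure $M$ on infinite matrices, concentrated on symmetric matrices, that is invariant and ergodic under all simultaneous permutations of rows and columns, and is the law of $\|F(\xi_i,\xi_j,\lambda_{ij})\|_{i,j}$ for some measurable $F:[0,1]^3\to\mathbb R$ such that $F(x,y,\cdot)$ is a.e. constant for a.e. $(x,y)$ and $F(x,x,\cdot)$ is a.e. constant for a.e. $x$. Let $(X_1,\mu_1)$, $(X_2,\mu_2)$ be standard Borel probability spaces (atoms are allowed) and $f:X_1\times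 X_2\to\mathbb R$ measurable. The *matrix distribution* $D_f$ is the law of $\|f(x_i,y_j)\|_{i,j}$, where $(x_i)$, $(y_j)$ are independent i.i.d. sequences with laws $\mu_1$, $\mu_2$. If $f$ is a symmetric measurable function on $X\times X$, where $(X,\mu)$ is a standard Borel probability space, its *symmetric matrix distribution* $D^{\mathrm{sym}}_f$ is the law of $\|f(x_i,x_j)\|_{i,j}$ with $(x_i)$ i.i.d. of law $\mu$. The function $f$ is *pure* if the maps $x\mapsto f(x,\cdot)$ and $y\mapsto f(\cdot,y)$ into classes of a.e. equal functions are injective on sets of full measure. Functions $f$ on $X_1\times X_2$ and $g$ on $Y_1\times Y_2$ are *isomorphic* if $g(T_1x,T_2y)=f(x,y)$ for a.e. $(x,y)$, for some measure-preserving maps $T_j:X_j\to Y_j$ invertible mod 0; symmetric functions on $X\times X$ and $Y\times Y$ are *isomorphic* if this holds with $T_1=T_2$. **Proposition.** 1. Let $M$ be an Aldous measure with zero $\lambda$. (a) $M=D_f$ for some measurable $f:[0,1]^2\to\mathbb R$, where $[0,1]$ carries the Lebesgue measure. (b) $M=D_f$ for some pure measurable function $f$ on a product of two standard Borel probability spaces.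 (c) If $f$ and $g$ are pure measurable functions on products of standard Borel probability spaces and $D_f=M$, then $D_g=M$ if and only if $f$ and $g$ are isomorphic. 2. Let $M$ be a symmetric Aldous measure with zero $\lambda$. (a) $M=D^{\mathrm{sym}}_f$ for some symmetric measurable $f:[0,1]^2\to\mathbb R$, where $[0,1]$ carries the Lebesgue measure. (b) There are a standard Borel probability space $(X,\mu)$ and a pure symmetric measurable function $f$ on $X\times X$ such that $D^{\mathrm{sym}}_f$ and $M$ agree off the diagonal, that is, they induce the same law on the arrays $(A_{ij})_{i\neq j}$. (c) If $f$ and $g$ are pure symmetric measurable functions on squares of standard Borel probability spaces and $D^{\mathrm{sym}}_f$ agrees with $M$ off the diagonal, then $D^{\mathrm{sym}}_g$ agrees with $M$ off the diagonal if and only if $f$ and $g$ are isomorphic by one and the same transformation of both variables. -/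

import Mathlib

open MeasureTheory Filter
open scoped unitInterval

universe u₁ u₂ v₁ v₂

noncomputable section

/-- Infinite real matrices, with the product (= Borel) sigma-algebra. -/
abbrev InfMatrix : Type := ℕ → ℕ → ℝ

/-- The product (Bernoulli) measure `μ^∞` on sequences: the law of an i.i.d. sequence with
common law `μ`. -/
abbrev bernoulliMeasure {X : Type*} [MeasurableSpace X] (μ : Measure X) : Measure (ℕ → X) :=
  Measure.infinitePi (fun _ : ℕ => μ)

/-! ### Group actions on matrices -/

/-- Row and column permutations: `(s, t)` moves row `i` to row `s i` and column `j` to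
column `t j`. -/
def permRowsCols (g : Equiv.Perm ℕ × Equiv.Perm ℕ) (A : InfMatrix) : InfMatrix :=
  fun i j => A (g.1.symm i) (g.2.symm j)

/-- Simultaneous permutations of rows and columns. -/
def permDiag (s : Equiv.Perm ℕ) (A : InfMatrix) : InfMatrix :=
  permRowsCols (s, s) A

/-- The measure `M` is invariant and ergodic for the family of transformations `act`. -/
structure IsInvariantErgodic {G Ω : Type*} [MeasurableSpace Ω] (act : G → Ω → Ω)
    (M : Measure Ω) : Prop where
  invariant : ∀ g, MeasurePreserving (act g) M M
  ergodic : ∀ s : Set Ω, MeasurableSet s → (∀ g, act g ⁻¹' s =ᵐ[M] s) → M s = 0 ∨ M sᶜ = 0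

/-! ### Aldous measures -/

/-- The law of the matrix `F (ξ i, η j, lam (i, j))`, where all the `ξ i`, `η j`, `lam (i, j)` are
independent and uniformly distributed on the unit interval. -/
def aldousLaw (F : I → I → I → ℝ) : Measure InfMatrix :=
  ((bernoulliMeasure (volume : Measure I)).prod ((bernoulliMeasure (volume : Measure I)).prod
      (Measure.infinitePi (fun _ : ℕ × ℕ => (volume : Measure I))))).map
    (fun w i j => F (w.1 i) (w.2.1 j) (w.2.2 (i, j)))

/-- The law of the matrix `F (ξ i, ξ j, lam (i, j))`, where all the `ξ i`, `lam (i, j)` are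
independent and uniformly distributed on the unit interval. -/
def aldousLawDiag (F : I → I → I → ℝ) : Measure InfMatrix :=
  ((bernoulliMeasure (volume : Measure I)).prod
      (Measure.infinitePi (fun _ : ℕ × ℕ => (volume : Measure I)))).map
    (fun w i j => F (w.1 i) (w.1 j) (w.2 (i, j)))

/-- The function `t` on the unit interval is constant almost everywhere. -/
def AEConst (t : I → ℝ) : Prop := ∃ c : ℝ, ∀ᵐ z : I, t z = c

/-- An ergodic measure, invariant under all permutations of rows and columns, with a
representation `F (ξ i, η j, lam (i, j))` in which (mod 0) `F` does not depend on `lam`. -/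
structure IsAldousZeroLambda (M : Measure InfMatrix) : Prop where
  invErgodic : IsInvariantErgodic permRowsCols M
  repr : ∃ F : I → I → I → ℝ, Measurable (fun p : I × I × I => F p.1 p.2.1 p.2.2) ∧
    (∀ᵐ p : I × I, AEConst (F p.1 p.2)) ∧ aldousLaw F = M

/-- An ergodic measure on symmetric matrices, invariant under simultaneous permutations of rows
and columns, with a representation `F (ξ i, ξ j, lam (i, j))` in which (mod 0) no entry, on or
off the diagonal, depends on `lam`. -/
structure IsSymmAldousZeroLambda (M : Measure InfMatrix) : Prop where
  invErgodic : IsInvariantErgodic permDiag M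
  symm : ∀ᵐ A ∂M, ∀ i j, A i j = A j i
  repr : ∃ F : I → I → I → ℝ, Measurable (fun p : I × I × I => F p.1 p.2.1 p.2.2) ∧
    (∀ᵐ p : I × I, AEConst (F p.1 p.2)) ∧ (∀ᵐ x : I, AEConst (F x x)) ∧ aldousLawDiag F = M

/-! ### Matrix distributions -/

/-- The matrix distribution of a function of two variables: the law of `f (x i, y j)` on a
Bernoulli grid. -/
def matrixDistribution {X Y : Type*} [MeasurableSpace X] [MeasurableSpace Y]
    (μ : Measure X) (ν : Measure Y) (f : X → Y → ℝ) : Measure InfMatrix :=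
  ((bernoulliMeasure μ).prod (bernoulliMeasure ν)).map (fun w i j => f (w.1 i) (w.2 j))

/-- The matrix distribution on symmetric grids: the law of `f (x i, x j)`. -/
def symmMatrixDistribution {X : Type*} [MeasurableSpace X]
    (μ : Measure X) (f : X → X → ℝ) : Measure InfMatrix :=
  (bernoulliMeasure μ).map (fun x i j => f (x i) (x j))

/-- The array of off-diagonal entries of a matrix. -/
def offDiagPart (A : InfMatrix) : {p : ℕ × ℕ // p.1 ≠ p.2} → ℝ :=
  fun p => A p.1.1 p.1.2

/-! ### Pure functions and isomorphism -/

/-- A function of two variables is pure if the maps `x ↦ f (x, ·)` and `y ↦ f (·, y)` into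
classes of a.e. equal functions are one-to-one mod 0. -/
def IsPure {X Y : Type*} [MeasurableSpace X] [MeasurableSpace Y]
    (μ : Measure X) (ν : Measure Y) (f : X → Y → ℝ) : Prop :=
  (∃ s ∈ ae μ, ∀ x ∈ s, ∀ x' ∈ s, (∀ᵐ y ∂ν, f x y = f x' y) → x = x') ∧
  (∃ t ∈ ae ν, ∀ y ∈ t, ∀ y' ∈ t, (∀ᵐ x ∂μ, f x y = f x y') → y = y')

/-- `T` is an invertible (mod 0) measure-preserving map. -/
def IsModZeroIso {X Y : Type*} [MeasurableSpace X] [MeasurableSpace Y]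
    (μ : Measure X) (ν : Measure Y) (T : X → Y) : Prop :=
  MeasurePreserving T μ ν ∧ ∃ S : Y → X, MeasurePreserving S ν μ ∧
    (∀ᵐ x ∂μ, S (T x) = x) ∧ (∀ᵐ y ∂ν, T (S y) = y)

/-- Isomorphism of functions of two variables: `g (T₁ x, T₂ y) = f (x, y)` almost everywhere. -/
def FunIso {X₁ X₂ Y₁ Y₂ : Type*} [MeasurableSpace X₁] [MeasurableSpace X₂]
    [MeasurableSpace Y₁] [MeasurableSpace Y₂]
    (μ₁ : Measure X₁) (μ₂ : Measure X₂) (f : X₁ → X₂ → ℝ)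
    (ν₁ : Measure Y₁) (ν₂ : Measure Y₂) (g : Y₁ → Y₂ → ℝ) : Prop :=
  ∃ (T₁ : X₁ → Y₁) (T₂ : X₂ → Y₂), IsModZeroIso μ₁ ν₁ T₁ ∧ IsModZeroIso μ₂ ν₂ T₂ ∧
    ∀ᵐ p ∂(μ₁.prod μ₂), g (T₁ p.1) (T₂ p.2) = f p.1 p.2

/-- Isomorphism of symmetric functions, with the same transformation of both variables. -/
def SymmFunIso {X Y : Type*} [MeasurableSpace X] [MeasurableSpace Y]
    (μ : Measure X) (f : X → X → ℝ) (ν : Measure Y) (g : Y → Y → ℝ) : Prop :=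
  ∃ T : X → Y, IsModZeroIso μ ν T ∧ ∀ᵐ p ∂(μ.prod μ), g (T p.1) (T p.2) = f p.1 p.2

end

/-! Elimination of `lam`: the almost sure value of `F x y ·` is found by integration, after
squashing the reals into a bounded interval, and is therefore measurable in `(x, y)`. Substituting
it gives (a). The diagonal is treated separately, because almost everywhere statements about pairs
do not reach it.

Purification: a section `f x` is coded by the integrals of its squashed values over a countable
generating pi-system. By `exists_factor_code`, measurable Radon-Nikodym derivatives let `f` factor,
mod 0, through the codes of both variables. The factor is pure because a generic point is the code
of its own section (`exists_injOn_sections_of_factor_code`). Factors inherit the matrix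
distribution; for symmetric grids only off the diagonal, where pairs of coordinates have the product
law.

Uniqueness: split the grid into even and odd indices, and call the even points `a`, `a'` a sample.
Independent pairs of odd points then exhibit repeatedly the triple `sampleMap`: the section of `x`
along `a'`, the section of `y` along `a`, and `f x y`. The frequencies of these triples, by the
strong law, are a function of the matrix that gives the law of one triple for the given sample. If
two matrix distributions agree, these random laws are equidistributed, so they coincide for some
pair of generic samples (`exists_map_eq_of_map_samples_eq`). For a pure function and a generic
sample, the sampled section determines the point, since averages along the sample recover the code
(`ae_exists_leftInverse`). Hence equal laws of the sampled sections yield the isomorphisms, and the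
third entry of the triple yields the relation between `f` and `g`. -/

noncomputable section

open ProbabilityTheory hiding bernoulliMeasure
open Set Topology
open scoped ENNReal

/-! ### Preliminaries -/

/-- A countably generated sigma-algebra has a countable generating pi-system containing the whole
space. -/
lemma exists_seq_generating_piSystem (X : Type*) [mX : MeasurableSpace X]
    [MeasurableSpace.CountablyGenerated X] :
    ∃ A : ℕ → Set X, (∀ m, MeasurableSet (A m)) ∧ IsPiSystem (range A) ∧
      mX = MeasurableSpace.generateFrom (range A) ∧ ∃ m, A m = univ := by
  let 𝒜 := generateSetAlgebra (MeasurableSpace.countableGeneratingSet X)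
  have hS : IsSetAlgebra 𝒜 := isSetAlgebra_generateSetAlgebra
  have hc : 𝒜.Countable := countable_generateSetAlgebra
    (MeasurableSpace.countable_countableGeneratingSet (α := X))
  have hne : 𝒜.Nonempty := ⟨_, hS.empty_mem⟩
  obtain ⟨A, hA⟩ := hc.exists_eq_range hne
  have hgen : mX = MeasurableSpace.generateFrom (range A) := by
    rw [← hA, generateFrom_generateSetAlgebra_eq,
      MeasurableSpace.generateFrom_countableGeneratingSet]
  have huniv : univ ∈ 𝒜 := by simpa using hS.compl_mem hS.empty_mem
  refine ⟨A, fun m => ?_, ?_, hgen, ?_⟩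
  · rw [hgen]
    exact MeasurableSpace.measurableSet_generateFrom (mem_range_self m)
  · rw [← hA]
    exact fun s hs t ht _ => hS.inter_mem hs ht
  · rw [hA] at huniv
    exact huniv

/-- The `m`-th member of a countable generating pi-system. -/
def genSet (X : Type*) [MeasurableSpace X] [MeasurableSpace.CountablyGenerated X] : ℕ → Set X :=
  (exists_seq_generating_piSystem X).choose

section GenSet

variable {X : Type*} [mX : MeasurableSpace X] [MeasurableSpace.CountablyGenerated X]

@[measurability]
lemma measurableSet_genSet (m : ℕ) : MeasurableSet (genSet X m) :=
  (exists_seq_generating_piSystem X).choose_spec.1 m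

lemma isPiSystem_range_genSet : IsPiSystem (range (genSet X)) :=
  (exists_seq_generating_piSystem X).choose_spec.2.1

lemma generateFrom_range_genSet : mX = MeasurableSpace.generateFrom (range (genSet X)) :=
  (exists_seq_generating_piSystem X).choose_spec.2.2.1

lemma exists_genSet_eq_univ : ∃ m, genSet X m = univ :=
  (exists_seq_generating_piSystem X).choose_spec.2.2.2

lemma measure_ext_genSet {μ ν : Measure X} [IsFiniteMeasure μ]
    (h : ∀ m, μ (genSet X m) = ν (genSet X m)) : μ = ν := by
  obtain ⟨m₀, hm₀⟩ := exists_genSet_eq_univ (X := X)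
  refine ext_of_generate_finite _ generateFrom_range_genSet isPiSystem_range_genSet ?_ ?_
  · rintro _ ⟨m, rfl⟩
    exact h m
  · rw [← hm₀, h]

/-- A family of finite measures of bounded mass is a measurable function of the parameter as soon
as it is so on the generating pi-system. -/
lemma measurable_measure_of_genSet {Y : Type*} [MeasurableSpace Y] (κ : Y → Measure X)
    [∀ y, IsFiniteMeasure (κ y)] (h : ∀ m, Measurable fun y => κ y (genSet X m)) :
    Measurable κ := by
  obtain ⟨m₀, hm₀⟩ := exists_genSet_eq_univ (X := X)
  refine Measure.measurable_of_measurable_coe _ fun s hs => ?_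
  refine MeasurableSpace.induction_on_inter (C := fun s _ => Measurable fun y => κ y s)
    generateFrom_range_genSet isPiSystem_range_genSet ?_ ?_ ?_ ?_ s hs
  · simp
  · rintro _ ⟨m, rfl⟩
    exact h m
  · intro t ht ih
    have : ∀ y, κ y tᶜ = κ y (genSet X m₀) - κ y t := fun y => by
      rw [measure_compl ht (measure_ne_top _ _), hm₀]
    simp_rw [this]
    exact (h m₀).sub ih
  · intro f hd hm ih
    simp_rw [measure_iUnion hd hm]
    exact Measurable.tsum ih

end GenSet

/-- A bounded injective coding of the real numbers. -/
def squash (t : ℝ) : ℝ≥0∞ := ENNReal.ofReal (Real.arctan t + Real.pi / 2)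

/-- The inverse of `squash`. -/
def unsquash (v : ℝ≥0∞) : ℝ := Real.tan (v.toReal - Real.pi / 2)

@[fun_prop]
lemma measurable_squash : Measurable squash := by
  unfold squash
  exact ((Real.continuous_arctan.measurable).add_const _).ennreal_ofReal

@[fun_prop]
lemma measurable_unsquash : Measurable unsquash := by
  have h : Measurable Real.tan := by
    have : Real.tan = fun x => Real.sin x / Real.cos x := funext Real.tan_eq_sin_div_cos
    rw [this]
    exact Real.measurable_sin.div Real.measurable_cos
  exact h.comp (ENNReal.measurable_toReal.sub_const _)

lemma unsquash_squash (t : ℝ) : unsquash (squash t) = t := by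
  unfold squash unsquash
  rw [ENNReal.toReal_ofReal (by linarith [Real.neg_pi_div_two_lt_arctan t])]
  simp [Real.tan_arctan]

lemma squash_injective : Function.Injective squash :=
  Function.LeftInverse.injective unsquash_squash

lemma squash_le (t : ℝ) : squash t ≤ ENNReal.ofReal Real.pi :=
  ENNReal.ofReal_le_ofReal (by linarith [Real.arctan_lt_pi_div_two t])

lemma squash_ne_top (t : ℝ) : squash t ≠ ∞ := ENNReal.ofReal_ne_top

/-- The symmetrization of a function: the common value of `f x y` and `f y x`, if there is one. -/
def symmetrize {X : Type*} (f : X → X → ℝ) (x y : X) : ℝ :=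
  open Classical in if f x y = f y x then f x y else 0

lemma symmetrize_symm {X : Type*} (f : X → X → ℝ) (x y : X) :
    symmetrize f x y = symmetrize f y x := by
  unfold symmetrize
  by_cases h : f x y = f y x
  · rw [if_pos h, if_pos h.symm, h]
  · rw [if_neg h, if_neg (Ne.symm h)]

lemma symmetrize_of_eq {X : Type*} {f : X → X → ℝ} {x y : X} (h : f x y = f y x) :
    symmetrize f x y = f x y := if_pos h

lemma measurable_symmetrize {X : Type*} [MeasurableSpace X] {f : X → X → ℝ}
    (hf : Measurable fun p : X × X => f p.1 p.2) :
    Measurable fun p : X × X => symmetrize f p.1 p.2 :=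
  Measurable.ite (measurableSet_eq_fun hf (hf.comp measurable_swap)) hf measurable_const

/-! ### Product measures on sequences -/

section Sequences

variable {X Y : Type*}

/-- The sequence with even terms `a` and odd terms `b`. -/
def interleave (a b : ℕ → X) (n : ℕ) : X := Sum.elim a b (Equiv.natSumNatEquivNat.symm n)

/-- Even indices. -/
def evenIdx (n : ℕ) : ℕ := Equiv.natSumNatEquivNat (Sum.inl n)

/-- Odd indices. -/
def oddIdx (n : ℕ) : ℕ := Equiv.natSumNatEquivNat (Sum.inr n)

@[simp]
lemma interleave_evenIdx (a b : ℕ → X) (n : ℕ) : interleave a b (evenIdx n) = a n := by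
  simp [interleave, evenIdx]

@[simp]
lemma interleave_oddIdx (a b : ℕ → X) (n : ℕ) : interleave a b (oddIdx n) = b n := by
  simp [interleave, oddIdx]

lemma evenIdx_ne_oddIdx (m n : ℕ) : evenIdx m ≠ oddIdx n := by
  simp [evenIdx, oddIdx]
  omega

lemma evenIdx_injective : Function.Injective evenIdx :=
  Equiv.natSumNatEquivNat.injective.comp Sum.inl_injective

lemma oddIdx_injective : Function.Injective oddIdx :=
  Equiv.natSumNatEquivNat.injective.comp Sum.inr_injective

variable [MeasurableSpace X] [MeasurableSpace Y]

lemma measurable_interleave :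
    Measurable fun p : (ℕ → X) × (ℕ → X) => interleave p.1 p.2 := by
  refine measurable_pi_lambda _ fun n => ?_
  unfold interleave
  cases Equiv.natSumNatEquivNat.symm n <;> simp <;> fun_prop

/-- Over the index set `ℕ ⊕ ℕ` a finite cylinder is a product of a cylinder in `a` and one in `b`.
This allows one i.i.d. sequence to be read as independent parameters and samples. -/
lemma measurePreserving_interleave (μ : Measure X)
    [IsProbabilityMeasure μ] :
    MeasurePreserving (fun p : (ℕ → X) × (ℕ → X) => interleave p.1 p.2)
      ((bernoulliMeasure μ).prod (bernoulliMeasure μ)) (bernoulliMeasure μ) := by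
  refine ⟨measurable_interleave, Measure.eq_infinitePi _ fun s t ht => ?_⟩
  have key : ∀ s' : Finset (ℕ ⊕ ℕ), ∀ t' : ℕ ⊕ ℕ → Set X, (∀ i, MeasurableSet (t' i)) →
      ((bernoulliMeasure μ).prod (bernoulliMeasure μ))
        {p | ∀ i ∈ s', Sum.elim p.1 p.2 i ∈ t' i} = ∏ i ∈ s', μ (t' i) := by
    intro s' t' ht'
    have : {p : (ℕ → X) × (ℕ → X) | ∀ i ∈ s', Sum.elim p.1 p.2 i ∈ t' i} =
        (Set.pi s'.toLeft fun i => t' (Sum.inl i)) ×ˢ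
          (Set.pi s'.toRight fun i => t' (Sum.inr i)) := by
      ext p
      simp [Set.mem_pi]
    rw [this, Measure.prod_prod, Measure.infinitePi_pi _ fun i _ => ht' _,
      Measure.infinitePi_pi _ fun i _ => ht' _]
    conv_rhs => rw [← Finset.toLeft_disjSum_toRight (u := s'), Finset.prod_disjSum]
  rw [Measure.map_apply measurable_interleave (.pi s.countable_toSet fun i _ => ht i)]
  have := key (s.map Equiv.natSumNatEquivNat.symm.toEmbedding)
    (fun i => t (Equiv.natSumNatEquivNat i)) fun i => ht _
  rw [Finset.prod_map] at this
  simp only [Equiv.coe_toEmbedding, Equiv.apply_symm_apply] at this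
  rw [← this]
  congr 1
  ext p
  simp only [mem_ofPred_eq, Finset.forall_mem_map, Equiv.coe_toEmbedding, Equiv.apply_symm_apply]
  rfl

/-- Two distinct coordinates of an i.i.d. sequence. -/
lemma measurePreserving_eval_pair (μ : Measure X) [IsProbabilityMeasure μ] {i j : ℕ}
    (hij : i ≠ j) :
    MeasurePreserving (fun x : ℕ → X => (x i, x j)) (bernoulliMeasure μ) (μ.prod μ) :=
  ⟨by fun_prop, Measure.infinitePi_map_eval_prod (P := fun _ : ℕ => μ) hij⟩

/-- A coordinate of each of two independent i.i.d. sequences. -/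
lemma measurePreserving_eval_prod (μ : Measure X) [IsProbabilityMeasure μ] (ν : Measure Y)
    [IsProbabilityMeasure ν] (i j : ℕ) :
    MeasurePreserving (fun w : (ℕ → X) × (ℕ → Y) => (w.1 i, w.2 j))
      ((bernoulliMeasure μ).prod (bernoulliMeasure ν)) (μ.prod ν) :=
  (measurePreserving_eval_infinitePi (fun _ : ℕ => μ) i).prod
    (measurePreserving_eval_infinitePi (fun _ : ℕ => ν) j)

end Sequences

/-! ### Transport of matrix distributions -/

section Transport

variable {X Y X' Y' : Type*} [MeasurableSpace X] [MeasurableSpace Y] [MeasurableSpace X']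
  [MeasurableSpace Y']

lemma measurePreserving_bernoulliMeasure {μ : Measure X} [IsProbabilityMeasure μ]
    {μ' : Measure X'} {T : X → X'} (hT : MeasurePreserving T μ μ') :
    MeasurePreserving (fun (x : ℕ → X) i => T (x i)) (bernoulliMeasure μ)
      (bernoulliMeasure μ') := by
  have hm := hT.measurable
  refine ⟨by fun_prop, ?_⟩
  have := Measure.infinitePi_map_pi (fun _ : ℕ => μ) (f := fun _ => T) fun _ => hm
  simpa only [hT.map_eq] using this

lemma measurable_grid {f : X → Y → ℝ} (hf : Measurable fun p : X × Y => f p.1 p.2) :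
    Measurable fun (w : (ℕ → X) × (ℕ → Y)) (i j : ℕ) => f (w.1 i) (w.2 j) := by
  refine measurable_pi_lambda _ fun i => measurable_pi_lambda _ fun j => ?_
  have h : Measurable fun w : (ℕ → X) × (ℕ → Y) => (w.1 i, w.2 j) := by fun_prop
  exact hf.comp h

lemma measurable_symmGrid {f : X → X → ℝ} (hf : Measurable fun p : X × X => f p.1 p.2) :
    Measurable fun (x : ℕ → X) (i j : ℕ) => f (x i) (x j) :=
  (measurable_grid hf).comp (measurable_id.prodMk measurable_id)

lemma measurable_offDiagPart : Measurable offDiagPart := by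
  unfold offDiagPart
  fun_prop

variable {μ : Measure X} {ν : Measure Y} {μ' : Measure X'} {ν' : Measure Y'}
  [IsProbabilityMeasure μ] [IsProbabilityMeasure ν]

/-- The matrix distribution is inherited by factors. -/
lemma matrixDistribution_eq_of_ae_eq {f : X → Y → ℝ} {g : X' → Y' → ℝ} {T₁ : X → X'}
    {T₂ : Y → Y'}
    (hg : Measurable fun p : X' × Y' => g p.1 p.2)
    (hT₁ : MeasurePreserving T₁ μ μ') (hT₂ : MeasurePreserving T₂ ν ν')
    (h : ∀ᵐ p ∂(μ.prod ν), g (T₁ p.1) (T₂ p.2) = f p.1 p.2) :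
    matrixDistribution μ' ν' g = matrixDistribution μ ν f := by
  have : IsProbabilityMeasure μ' := hT₁.map_eq ▸ Measure.isProbabilityMeasure_map hT₁.aemeasurable
  have : IsProbabilityMeasure ν' := hT₂.map_eq ▸ Measure.isProbabilityMeasure_map hT₂.aemeasurable
  have hT := (measurePreserving_bernoulliMeasure hT₁).prod (measurePreserving_bernoulliMeasure hT₂)
  unfold matrixDistribution
  rw [← hT.map_eq, Measure.map_map (measurable_grid hg) hT.measurable]
  refine Measure.map_congr ?_
  have : ∀ i j : ℕ, ∀ᵐ w ∂(bernoulliMeasure μ).prod (bernoulliMeasure ν),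
      g (T₁ (w.1 i)) (T₂ (w.2 j)) = f (w.1 i) (w.2 j) := fun i j =>
    (measurePreserving_eval_prod μ ν i j).quasiMeasurePreserving.ae h
  filter_upwards [ae_all_iff.2 fun i => ae_all_iff.2 (this i)] with w hw
  funext i j
  exact hw i j

/-- The off-diagonal part of the symmetric matrix distribution is inherited by factors. -/
lemma map_offDiagPart_eq_of_ae_eq {f : X → X → ℝ} {g : X' → X' → ℝ} {T : X → X'}
    (hf : Measurable fun p : X × X => f p.1 p.2)
    (hg : Measurable fun p : X' × X' => g p.1 p.2) (hT : MeasurePreserving T μ μ')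
    (h : ∀ᵐ p ∂(μ.prod μ), g (T p.1) (T p.2) = f p.1 p.2) :
    (symmMatrixDistribution μ' g).map offDiagPart =
      (symmMatrixDistribution μ f).map offDiagPart := by
  have : IsProbabilityMeasure μ' := hT.map_eq ▸ Measure.isProbabilityMeasure_map hT.aemeasurable
  have hT' := measurePreserving_bernoulliMeasure hT
  unfold symmMatrixDistribution
  rw [← hT'.map_eq, Measure.map_map (measurable_symmGrid hg) hT'.measurable,
    Measure.map_map measurable_offDiagPart ((measurable_symmGrid hg).comp hT'.measurable),
    Measure.map_map measurable_offDiagPart (measurable_symmGrid hf)]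
  refine Measure.map_congr ?_
  -- Two distinct coordinates have law `μ.prod μ`, so `h` applies; about `(x i, x i)` it says
  -- nothing.
  have : ∀ p : {p : ℕ × ℕ // p.1 ≠ p.2}, ∀ᵐ x ∂bernoulliMeasure μ,
      g (T (x p.1.1)) (T (x p.1.2)) = f (x p.1.1) (x p.1.2) := fun p =>
    (measurePreserving_eval_pair μ p.2).quasiMeasurePreserving.ae h
  filter_upwards [ae_all_iff.2 this] with x hx
  funext p
  exact hx p

end Transport

/-! ### Coding the sections of a function -/

section Code

variable {X Y : Type*} [MeasurableSpace Y]

/-- The integrals of the section `f (x, ·)`, squashed, over a generating family of sets. -/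
def code [MeasurableSpace.CountablyGenerated Y] (ν : Measure Y) (f : X → Y → ℝ) (x : X) (m : ℕ) : ℝ≥0∞ :=
  ∫⁻ y in genSet Y m, squash (f x y) ∂ν

/-- The measure with density the squashed section `f (x, ·)`. -/
def sectionMeasure (ν : Measure Y) (f : X → Y → ℝ) (x : X) : Measure Y :=
  ν.withDensity fun y => squash (f x y)

variable {ν : Measure Y} {f : X → Y → ℝ}

lemma sectionMeasure_le [IsProbabilityMeasure ν] (x : X) :
    sectionMeasure ν f x univ ≤ ENNReal.ofReal Real.pi := by
  rw [sectionMeasure, withDensity_apply _ .univ, Measure.restrict_univ]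
  exact (lintegral_mono fun y => squash_le _).trans (by simp)

instance [IsProbabilityMeasure ν] (x : X) : IsFiniteMeasure (sectionMeasure ν f x) :=
  ⟨(sectionMeasure_le x).trans_lt ENNReal.ofReal_lt_top⟩

variable [MeasurableSpace.CountablyGenerated Y]

lemma sectionMeasure_genSet (x : X) (m : ℕ) :
    sectionMeasure ν f x (genSet Y m) = code ν f x m :=
  withDensity_apply _ (measurableSet_genSet m)

lemma measurable_code [MeasurableSpace X] [SFinite ν] (hf : Measurable fun p : X × Y => f p.1 p.2) :
    Measurable (code ν f) := by
  refine measurable_pi_lambda _ fun m => ?_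
  exact (measurable_squash.comp hf).lintegral_prod_right'

/-- On the generating sets the measure takes the coordinates of the code as values. Measurability
for the sigma-algebra generated by the code is what makes densities factor through the code. -/
lemma measurable_comap_sectionMeasure [IsProbabilityMeasure ν] :
    @Measurable _ _ (MeasurableSpace.comap (code ν f) inferInstance) _ (sectionMeasure ν f) := by
  let _ := MeasurableSpace.comap (code ν f) inferInstance
  refine measurable_measure_of_genSet _ fun m => ?_
  simp_rw [sectionMeasure_genSet]
  exact (measurable_pi_apply m).comp (comap_measurable (code ν f))

/-- The code of a section determines the section. -/
lemma ae_eq_of_code_eq [IsProbabilityMeasure ν] (hf : ∀ x, Measurable (f x)) {x x' : X}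
    (h : code ν f x = code ν f x') : ∀ᵐ y ∂ν, f x y = f x' y := by
  have : sectionMeasure ν f x = sectionMeasure ν f x' :=
    measure_ext_genSet fun m => by rw [sectionMeasure_genSet, sectionMeasure_genSet, h]
  have hm : ∀ x, AEMeasurable (fun y => squash (f x y)) ν := fun x =>
    (measurable_squash.comp (hf x)).aemeasurable
  have hfin : ∫⁻ y, squash (f x y) ∂ν ≠ ∞ := by
    have := measure_ne_top (sectionMeasure ν f x) univ
    rwa [sectionMeasure, withDensity_apply _ .univ, Measure.restrict_univ] at this
  filter_upwards [(withDensity_eq_iff (hm x) (hm x') hfin).1 this] with y hy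
  exact squash_injective hy

end Code

/-! ### Purification -/

section Purification

/-- Measurable choice of Radon-Nikodym derivatives, depending on the parameter through `Ψ`. -/
lemma exists_measurable_rnDeriv {Y U V : Type*} [MeasurableSpace U] [MeasurableSpace V]
    [MeasurableSpace.CountablyGenerated U] {Ψ : Y → V} {κ : Y → Measure U} {ρ : Measure U}
    [IsFiniteMeasure ρ] (hκ : @Measurable _ _ (MeasurableSpace.comap Ψ inferInstance) _ κ)
    {C : ℝ≥0∞} (hC : C < ∞) (hb : ∀ y, κ y univ ≤ C) :
    ∃ g : V × U → ℝ≥0∞, Measurable g ∧ ∀ y, (fun u => g (Ψ y, u)) =ᵐ[ρ] (κ y).rnDeriv ρ := by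
  -- With the sigma-algebra generated by `Ψ` on `Y`, joint measurability of the kernel derivative
  -- means precisely that it factors through `Prod.map Ψ id`.
  let mY : MeasurableSpace Y := MeasurableSpace.comap Ψ inferInstance
  let K : Kernel Y U := ⟨κ, hκ⟩
  have : IsFiniteKernel K := ⟨C, hC, hb⟩
  have hr := Kernel.measurable_rnDeriv K (Kernel.const Y ρ)
  have hle : (inferInstance : MeasurableSpace (Y × U)) ≤
      MeasurableSpace.comap (Prod.map Ψ id) (inferInstance : MeasurableSpace (V × U)) := by
    refine sup_le ?_ ?_
    · rw [MeasurableSpace.comap_comp]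
      exact (measurable_fst.comp (comap_measurable (Prod.map Ψ (id : U → U)))).comap_le
    · exact (measurable_snd.comp (comap_measurable (Prod.map Ψ (id : U → U)))).comap_le
  obtain ⟨g, hg, hgr⟩ := (hr.mono hle le_rfl).exists_eq_measurable_comp
  refine ⟨g, hg, fun y => ?_⟩
  have := Kernel.rnDeriv_eq_rnDeriv_measure (κ := K) (η := Kernel.const Y ρ) (a := y)
  rw [Kernel.const_apply] at this
  filter_upwards [this] with u hu
  have h2 := congrFun hgr (y, u)
  simp only [Function.comp_apply, Prod.map_apply, id] at h2
  rw [← h2, hu]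
  rfl

variable {X Y : Type*} [MeasurableSpace X] [MeasurableSpace Y]
  [MeasurableSpace.CountablyGenerated Y]
  {μ : Measure X} {ν : Measure Y} [IsProbabilityMeasure ν]
  {f : X → Y → ℝ}

/-- In a factor through the codes of the sections, the first variable is determined mod 0 by the
section. -/
lemma exists_injOn_sections_of_factor_code {V : Type*} [MeasurableSpace V]
    {g : (ℕ → ℝ≥0∞) → V → ℝ} (hf : Measurable fun p : X × Y => f p.1 p.2)
    (hg : Measurable fun p : (ℕ → ℝ≥0∞) × V => g p.1 p.2) {Ψ : Y → V} (hΨ : Measurable Ψ)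
    (h : ∀ᵐ p ∂(μ.prod ν), g (code ν f p.1) (Ψ p.2) = f p.1 p.2) :
    ∃ s ∈ ae (μ.map (code ν f)), ∀ u ∈ s, ∀ u' ∈ s,
      (∀ᵐ v ∂(ν.map Ψ), g u v = g u' v) → u = u' := by
  have hm : Measurable (code ν fun u y => g u (Ψ y)) :=
    measurable_code (hg.comp (measurable_fst.prodMk (hΨ.comp measurable_snd)))
  -- For a.e. `x` the pulled-back section of `g` at the code of `x` is a.e. `f x`, so its code is
  -- that same point. Points with this property are determined by their sections.
  refine ⟨{u | code ν (fun u y => g u (Ψ y)) u = u}, ?_, fun u hu u' hu' huu' => ?_⟩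
  · change ∀ᵐ u ∂(μ.map (code ν f)), code ν (fun u y => g u (Ψ y)) u = u
    have hset : MeasurableSet {u | code ν (fun u y => g u (Ψ y)) u = u} :=
      measurableSet_eq_fun hm measurable_id
    rw [ae_map_iff (measurable_code hf).aemeasurable hset]
    filter_upwards [Measure.ae_ae_of_ae_prod h] with x hx
    funext m
    refine lintegral_congr_ae (ae_restrict_of_ae ?_)
    filter_upwards [hx] with y hy
    rw [hy]
  · rw [← show code ν (fun u y => g u (Ψ y)) u = u from hu,
      ← show code ν (fun u y => g u (Ψ y)) u' = u' from hu']
    funext m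
    refine lintegral_congr_ae (ae_restrict_of_ae ?_)
    filter_upwards [ae_of_ae_map hΨ.aemeasurable huu'] with y hy
    rw [hy]

variable [MeasurableSpace.CountablyGenerated X] [IsProbabilityMeasure μ]

/-- A function of two variables factors, mod 0, through the codes of its sections. -/
lemma exists_factor_code (hf : Measurable fun p : X × Y => f p.1 p.2) :
    ∃ g : (ℕ → ℝ≥0∞) → (ℕ → ℝ≥0∞) → ℝ,
      Measurable (fun p : (ℕ → ℝ≥0∞) × (ℕ → ℝ≥0∞) => g p.1 p.2) ∧
      ∀ᵐ p ∂(μ.prod ν), g (code ν f p.1) (code μ (fun y x => f x y) p.2) = f p.1 p.2 := by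
  have hf' : Measurable fun p : Y × X => f p.2 p.1 := hf.comp measurable_swap
  have hΦ : Measurable (code ν f) := measurable_code hf
  have hΨ : Measurable (code μ fun y x => f x y) := measurable_code hf'
  -- First half of the factorization: only `x` is replaced by its code.
  obtain ⟨h, hh, hhf⟩ := exists_measurable_rnDeriv (ρ := ν)
    (measurable_comap_sectionMeasure (ν := ν) (f := f)) ENNReal.ofReal_lt_top sectionMeasure_le
  have hhf' : ∀ᵐ y ∂ν, ∀ᵐ x ∂μ, h (code ν f x, y) = squash (f x y) := by
    refine Measure.ae_ae_comm (p := fun x y => h (code ν f x, y) = squash (f x y)) ?_ |>.1 ?_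
    · exact measurableSet_eq_fun (hh.comp ((hΦ.comp measurable_fst).prodMk measurable_snd))
        (measurable_squash.comp hf)
    · refine ae_of_all _ fun x => ?_
      filter_upwards [hhf x, Measure.rnDeriv_withDensity ν
        (measurable_squash.comp (hf.comp measurable_prodMk_left))] with y h1 h2
      exact h1.trans h2
  -- Second half: the section measure at `y` is pushed to the space of codes of `x`; its density
  -- there depends on `y` only through the code of `y`.
  have hκ : @Measurable _ _ (MeasurableSpace.comap (code μ fun y x => f x y) inferInstance) _
      fun y => (sectionMeasure μ (fun y x => f x y) y).map (code ν f) :=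
    (Measure.measurable_map _ hΦ).comp measurable_comap_sectionMeasure
  obtain ⟨g, hg, hgκ⟩ := exists_measurable_rnDeriv (ρ := μ.map (code ν f)) hκ
    ENNReal.ofReal_lt_top fun y => by
      rw [Measure.map_apply hΦ .univ]
      exact sectionMeasure_le y
  refine ⟨fun u v => unsquash (g (v, u)), measurable_unsquash.comp (hg.comp measurable_swap), ?_⟩
  have hmeas : MeasurableSet {p : X × Y |
      unsquash (g (code μ (fun y x => f x y) p.2, code ν f p.1)) = f p.1 p.2} :=
    measurableSet_eq_fun (measurable_unsquash.comp (hg.comp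
      ((hΨ.comp measurable_snd).prodMk (hΦ.comp measurable_fst)))) hf
  rw [Measure.ae_prod_iff_ae_ae hmeas]
  refine (Measure.ae_ae_comm hmeas).2 ?_
  filter_upwards [hhf'] with y hy
  have hhy : Measurable fun u => h (u, y) := hh.comp measurable_prodMk_right
  -- By `hy` the weight `squash (f x y)` is a.e. a function of the code of `x`, so it survives the
  -- push-forward as a density.
  have hmap : (sectionMeasure μ (fun y x => f x y) y).map (code ν f) =
      (μ.map (code ν f)).withDensity fun u => h (u, y) := by
    ext s hs
    rw [Measure.map_apply hΦ hs, sectionMeasure, withDensity_apply _ (hΦ hs),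
      withDensity_apply _ hs, setLIntegral_map hs hhy hΦ]
    exact (lintegral_congr_ae (ae_restrict_of_ae hy)).symm
  have hgy := hgκ y
  rw [hmap] at hgy
  have := hgy.trans (Measure.rnDeriv_withDensity _ hhy)
  filter_upwards [hy, ae_of_ae_map hΦ.aemeasurable this] with x h1 h2
  rw [h2, h1, unsquash_squash]

/-- The injectivity argument for codes applies to each variable in turn, after a swap. -/
lemma isPure_of_factor_code {g : (ℕ → ℝ≥0∞) → (ℕ → ℝ≥0∞) → ℝ}
    (hf : Measurable fun p : X × Y => f p.1 p.2)
    (hg : Measurable (fun p : (ℕ → ℝ≥0∞) × (ℕ → ℝ≥0∞) => g p.1 p.2))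
    (h : ∀ᵐ p ∂(μ.prod ν), g (code ν f p.1) (code μ (fun y x => f x y) p.2) = f p.1 p.2) :
    IsPure (μ.map (code ν f)) (ν.map (code μ fun y x => f x y)) g := by
  have hf' : Measurable fun p : Y × X => f p.2 p.1 := hf.comp measurable_swap
  have hg' : Measurable (fun p : (ℕ → ℝ≥0∞) × (ℕ → ℝ≥0∞) => g p.2 p.1) :=
    hg.comp measurable_swap
  refine ⟨exists_injOn_sections_of_factor_code hf hg (measurable_code hf') h,
    exists_injOn_sections_of_factor_code (f := fun y x => f x y) (g := fun v u => g u v)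
      hf' hg' (measurable_code hf) ?_⟩
  exact Measure.measurePreserving_swap.quasiMeasurePreserving.ae h

end Purification

/-- Every matrix distribution is that of a pure function. -/
lemma exists_isPure_matrixDistribution_eq {X Y : Type*} [MeasurableSpace X] [MeasurableSpace Y]
    [MeasurableSpace.CountablyGenerated X] [MeasurableSpace.CountablyGenerated Y]
    (μ : Measure X) (ν : Measure Y) [IsProbabilityMeasure μ] [IsProbabilityMeasure ν]
    {f : X → Y → ℝ} (hf : Measurable fun p : X × Y => f p.1 p.2) :
    ∃ (μ₁ μ₂ : Measure (ℕ → ℝ≥0∞)) (g : (ℕ → ℝ≥0∞) → (ℕ → ℝ≥0∞) → ℝ),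
      IsProbabilityMeasure μ₁ ∧ IsProbabilityMeasure μ₂ ∧
      Measurable (fun p : (ℕ → ℝ≥0∞) × (ℕ → ℝ≥0∞) => g p.1 p.2) ∧ IsPure μ₁ μ₂ g ∧
      matrixDistribution μ₁ μ₂ g = matrixDistribution μ ν f := by
  obtain ⟨g, hg, h⟩ := exists_factor_code (μ := μ) (ν := ν) hf
  have hΦ : Measurable (code ν f) := measurable_code hf
  have hΨ : Measurable (code μ fun y x => f x y) := measurable_code (hf.comp measurable_swap)
  exact ⟨_, _, g, Measure.isProbabilityMeasure_map hΦ.aemeasurable,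
    Measure.isProbabilityMeasure_map hΨ.aemeasurable, hg, isPure_of_factor_code hf hg h,
    matrixDistribution_eq_of_ae_eq hg (hΦ.measurePreserving μ) (hΨ.measurePreserving ν) h⟩

/-- Every symmetric matrix distribution is, off the diagonal, that of a pure symmetric function. -/
lemma exists_isPure_symmMatrixDistribution_eq {X : Type*} [MeasurableSpace X]
    [MeasurableSpace.CountablyGenerated X] (μ : Measure X) [IsProbabilityMeasure μ]
    {f : X → X → ℝ} (hf : Measurable fun p : X × X => f p.1 p.2)
    (hsymm : ∀ x y, f x y = f y x) :
    ∃ (μ₁ : Measure (ℕ → ℝ≥0∞)) (g : (ℕ → ℝ≥0∞) → (ℕ → ℝ≥0∞) → ℝ),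
      IsProbabilityMeasure μ₁ ∧ Measurable (fun p : (ℕ → ℝ≥0∞) × (ℕ → ℝ≥0∞) => g p.1 p.2) ∧
      (∀ u v, g u v = g v u) ∧ IsPure μ₁ μ₁ g ∧
      (symmMatrixDistribution μ₁ g).map offDiagPart =
        (symmMatrixDistribution μ f).map offDiagPart := by
  obtain ⟨g₀, hg₀, h₀⟩ := exists_factor_code (μ := μ) (ν := μ) hf
  have hΦ : Measurable (code μ f) := measurable_code hf
  have hswap : (fun y x => f x y) = f := by
    funext x y
    exact hsymm y x
  rw [hswap] at h₀
  have hg := measurable_symmetrize hg₀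
  -- At the codes of almost every pair, `g₀` already takes symmetric values because `f` does;
  -- symmetrizing changes nothing there.
  have h : ∀ᵐ p ∂(μ.prod μ), symmetrize g₀ (code μ f p.1) (code μ f p.2) = f p.1 p.2 := by
    filter_upwards [h₀, Measure.measurePreserving_swap.quasiMeasurePreserving.ae h₀] with p h1 h2
    rw [symmetrize_of_eq, h1]
    rw [h1, hsymm]
    exact h2.symm
  have hpure := isPure_of_factor_code hf hg (by rwa [hswap])
  rw [hswap] at hpure
  exact ⟨_, symmetrize g₀, Measure.isProbabilityMeasure_map hΦ.aemeasurable, hg,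
    symmetrize_symm g₀, hpure, map_offDiagPart_eq_of_ae_eq hf hg (hΦ.measurePreserving μ) h⟩

/-! ### Eliminating the variable `lam` -/

section AldousZeroLambda

/-- The almost sure value of `F (x, y, ·)`. -/
def sectionValue (F : I → I → I → ℝ) (x y : I) : ℝ := unsquash (∫⁻ z, squash (F x y z))

/-- The integral replaces a choice of the constant and so depends measurably on parameters;
squashing makes it meaningful without integrability of `t`. -/
lemma AEConst.ae_eq_unsquash {t : I → ℝ} (h : AEConst t) :
    ∀ᵐ z, t z = unsquash (∫⁻ z, squash (t z)) := by
  obtain ⟨c, hc⟩ := h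
  have : ∫⁻ z, squash (t z) = squash c := by
    rw [lintegral_congr_ae (g := fun _ => squash c)]
    · simp
    · filter_upwards [hc] with z hz
      rw [hz]
  rw [this, unsquash_squash]
  exact hc

variable {F : I → I → I → ℝ}

lemma measurable_sectionValue (hF : Measurable fun p : I × I × I => F p.1 p.2.1 p.2.2) :
    Measurable fun p : I × I => sectionValue F p.1 p.2 := by
  have h : Measurable fun q : (I × I) × I => F q.1.1 q.1.2 q.2 :=
    hF.comp MeasurableEquiv.prodAssoc.measurable
  exact measurable_unsquash.comp (measurable_squash.comp h).lintegral_prod_right'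

lemma ae_eq_sectionValue
    (hF : Measurable fun p : I × I × I => F p.1 p.2.1 p.2.2)
    (hc : ∀ᵐ p : I × I, AEConst (F p.1 p.2)) :
    ∀ᵐ q ∂((volume.prod volume : Measure (I × I)).prod (volume : Measure I)),
      F q.1.1 q.1.2 q.2 = sectionValue F q.1.1 q.1.2 := by
  have h : Measurable fun q : (I × I) × I => F q.1.1 q.1.2 q.2 :=
    hF.comp MeasurableEquiv.prodAssoc.measurable
  refine (Measure.ae_prod_iff_ae_ae (measurableSet_eq_fun h
    ((measurable_sectionValue hF).comp measurable_fst))).2 ?_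
  filter_upwards [hc] with p hp using hp.ae_eq_unsquash

lemma aldousLaw_eq_matrixDistribution
    (hF : Measurable fun p : I × I × I => F p.1 p.2.1 p.2.2)
    (hc : ∀ᵐ p : I × I, AEConst (F p.1 p.2)) :
    aldousLaw F = matrixDistribution volume volume (sectionValue F) := by
  let P := bernoulliMeasure (volume : Measure I)
  let Q := Measure.infinitePi (fun _ : ℕ × ℕ => (volume : Measure I))
  have hassoc : MeasurePreserving (MeasurableEquiv.prodAssoc.symm) (P.prod (P.prod Q))
      ((P.prod P).prod Q) := (measurePreserving_prodAssoc P P Q).symm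
  have hfst : MeasurePreserving Prod.fst ((P.prod P).prod Q) (P.prod P) := measurePreserving_fst
  have hproj := hfst.comp hassoc
  unfold aldousLaw matrixDistribution
  rw [← hproj.map_eq, Measure.map_map (measurable_grid (measurable_sectionValue hF))
    hproj.measurable]
  refine Measure.map_congr ?_
  have : ∀ i j : ℕ, ∀ᵐ w ∂P.prod (P.prod Q),
      F (w.1 i) (w.2.1 j) (w.2.2 (i, j)) = sectionValue F (w.1 i) (w.2.1 j) := fun i j =>
    (((measurePreserving_eval_prod volume volume i j).prod
      (measurePreserving_eval_infinitePi (fun _ : ℕ × ℕ => (volume : Measure I))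
        (i, j))).comp hassoc).quasiMeasurePreserving.ae (ae_eq_sectionValue hF hc)
  filter_upwards [ae_all_iff.2 fun i => ae_all_iff.2 (this i)] with w hw
  funext i j
  exact hw i j

/-- Diagonal entries sample `F` on the null set `x = y`, which `hc` does not control; for them `hd`
is used. -/
lemma aldousLawDiag_eq_symmMatrixDistribution
    (hF : Measurable fun p : I × I × I => F p.1 p.2.1 p.2.2)
    (hc : ∀ᵐ p : I × I, AEConst (F p.1 p.2))
    (hd : ∀ᵐ x : I, AEConst (F x x)) :
    aldousLawDiag F = symmMatrixDistribution volume (sectionValue F) := by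
  let P := bernoulliMeasure (volume : Measure I)
  let Q := Measure.infinitePi (fun _ : ℕ × ℕ => (volume : Measure I))
  have hfst : MeasurePreserving Prod.fst (P.prod Q) P := measurePreserving_fst
  have hQ := measurePreserving_eval_infinitePi (fun _ : ℕ × ℕ => (volume : Measure I))
  unfold aldousLawDiag symmMatrixDistribution
  change (P.prod Q).map _ = P.map _
  conv_rhs => rw [← hfst.map_eq, Measure.map_map
    (measurable_symmGrid (measurable_sectionValue hF)) measurable_fst]
  refine Measure.map_congr ?_
  have hdiag : ∀ᵐ q ∂((volume : Measure I).prod (volume : Measure I)),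
      F q.1 q.1 q.2 = sectionValue F q.1 q.1 := by
    have h : Measurable fun q : I × I => F q.1 q.1 q.2 :=
      hF.comp (measurable_fst.prodMk (measurable_fst.prodMk measurable_snd))
    refine (Measure.ae_prod_iff_ae_ae (measurableSet_eq_fun h
      ((measurable_sectionValue hF).comp (measurable_fst.prodMk measurable_fst)))).2 ?_
    filter_upwards [hd] with x hx using hx.ae_eq_unsquash
  have : ∀ i j : ℕ, ∀ᵐ w ∂P.prod Q,
      F (w.1 i) (w.1 j) (w.2 (i, j)) = sectionValue F (w.1 i) (w.1 j) := fun i j => by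
    by_cases hij : i = j
    · subst hij
      exact ((measurePreserving_eval_infinitePi (fun _ : ℕ => (volume : Measure I)) i).prod
        (hQ (i, i))).quasiMeasurePreserving.ae hdiag
    · exact ((measurePreserving_eval_pair volume hij).prod
        (hQ (i, j))).quasiMeasurePreserving.ae (ae_eq_sectionValue hF hc)
  filter_upwards [ae_all_iff.2 fun i => ae_all_iff.2 (this i)] with w hw
  funext i j
  exact hw i j

end AldousZeroLambda

lemma IsAldousZeroLambda.exists_matrixDistribution_eq {M : Measure InfMatrix}
    (hM : IsAldousZeroLambda M) :
    ∃ f : I → I → ℝ, Measurable (fun p : I × I => f p.1 p.2) ∧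
      matrixDistribution volume volume f = M := by
  obtain ⟨F, hF, hc, rfl⟩ := hM.repr
  exact ⟨sectionValue F, measurable_sectionValue hF, (aldousLaw_eq_matrixDistribution hF hc).symm⟩

/-- A measurable function with almost surely symmetric grids can be made symmetric. -/
lemma symmMatrixDistribution_symmetrize {X : Type*} [MeasurableSpace X] {μ : Measure X}
    {f : X → X → ℝ} (hf : Measurable fun p : X × X => f p.1 p.2)
    (h : ∀ᵐ A ∂symmMatrixDistribution μ f, ∀ i j, A i j = A j i) :
    symmMatrixDistribution μ (symmetrize f) = symmMatrixDistribution μ f := by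
  refine Measure.map_congr ?_
  filter_upwards [ae_of_ae_map (measurable_symmGrid hf).aemeasurable h] with x hx
  funext i j
  exact symmetrize_of_eq (hx i j)

lemma IsSymmAldousZeroLambda.exists_symmMatrixDistribution_eq {M : Measure InfMatrix}
    (hM : IsSymmAldousZeroLambda M) :
    ∃ f : I → I → ℝ, Measurable (fun p : I × I => f p.1 p.2) ∧ (∀ x y, f x y = f y x) ∧
      symmMatrixDistribution volume f = M := by
  obtain ⟨F, hF, hc, hd, hFM⟩ := hM.repr
  have hs := hM.symm
  rw [← hFM, aldousLawDiag_eq_symmMatrixDistribution hF hc hd] at hs ⊢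
  exact ⟨symmetrize (sectionValue F), measurable_symmetrize (measurable_sectionValue hF),
    symmetrize_symm _, symmMatrixDistribution_symmetrize (measurable_sectionValue hF) hs⟩

/-! ### Independent samples -/

section Samples

variable {S P Z : Type*} [MeasurableSpace S] [MeasurableSpace P] [MeasurableSpace Z]

/-- Strong law of large numbers for a bounded function of pairwise independent samples. -/
lemma tendsto_average_of_indepFun {τ : Measure S} [IsProbabilityMeasure τ] {π : Measure P}
    {p : ℕ → S → P} (hp : ∀ n, MeasurePreserving (p n) τ π)
    (hi : Pairwise fun m n => IndepFun (p m) (p n) τ) {φ : P → ℝ} (hφ : Measurable φ) {C : ℝ}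
    (hC : ∀ q, |φ q| ≤ C) :
    ∀ᵐ s ∂τ, Tendsto (fun n : ℕ => (∑ i ∈ Finset.range n, φ (p i s)) / n) atTop
      (𝓝 (∫ q, φ q ∂π)) := by
  have hm : ∀ n, Measurable fun s => φ (p n s) := fun n => hφ.comp (hp n).measurable
  have := strong_law_ae_real (μ := τ) (fun n s => φ (p n s))
    (Integrable.of_bound (hm 0).aestronglyMeasurable C (ae_of_all _ fun s => hC _))
    (fun m n hmn => (hi hmn).comp hφ hφ)
    (fun n => ⟨(hm n).aemeasurable, (hm 0).aemeasurable, by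
      rw [← Function.comp_def, ← Function.comp_def, ← Measure.map_map hφ (hp n).measurable,
        ← Measure.map_map hφ (hp 0).measurable, (hp n).map_eq, (hp 0).map_eq]⟩)
  have hint : ∫ s, φ (p 0 s) ∂τ = ∫ q, φ q ∂π := by
    rw [← (hp 0).map_eq, integral_map (hp 0).aemeasurable hφ.aestronglyMeasurable]
  rwa [hint] at this

variable [MeasurableSpace.CountablyGenerated Z]

/-- The asymptotic frequencies of the visits of a sequence to a generating family of sets. -/
def frequency (z : ℕ → Z) (m : ℕ) : ℝ :=
  limsup (fun n : ℕ => (∑ i ∈ Finset.range n, (genSet Z m).indicator (1 : Z → ℝ) (z i)) / n) atTop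

lemma measurable_indicator_genSet (m : ℕ) : Measurable ((genSet Z m).indicator (1 : Z → ℝ)) :=
  measurable_one.indicator (measurableSet_genSet m)

lemma measurable_frequency : Measurable (frequency (Z := Z)) := by
  refine measurable_pi_lambda _ fun m => Measurable.limsup fun n => ?_
  refine (Finset.measurable_sum _ fun i _ => ?_).div_const _
  exact (measurable_indicator_genSet m).comp (measurable_pi_apply i)

/-- The law of a sample is recovered from the sequence of samples. -/
lemma ae_frequency_eq {τ : Measure S} [IsProbabilityMeasure τ] {π : Measure P}
    {p : ℕ → S → P} (hp : ∀ n, MeasurePreserving (p n) τ π)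
    (hi : Pairwise fun m n => IndepFun (p m) (p n) τ) {θ : P → Z} (hθ : Measurable θ) :
    ∀ᵐ s ∂τ, frequency (fun n => θ (p n s)) = fun m => (π (θ ⁻¹' genSet Z m)).toReal := by
  have : ∀ m, ∀ᵐ s ∂τ, frequency (fun n => θ (p n s)) m = (π (θ ⁻¹' genSet Z m)).toReal := by
    intro m
    have h := tendsto_average_of_indepFun hp hi ((measurable_indicator_genSet m).comp hθ) (C := 1)
      fun q => by
        by_cases hq : θ q ∈ genSet Z m <;> simp [hq]
    filter_upwards [h] with s hs
    -- The upper limit is defined for every sequence; here it is the limit supplied by the strong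
    -- law.
    refine (Tendsto.limsup_eq hs).trans ?_
    have : ((genSet Z m).indicator (1 : Z → ℝ)) ∘ θ = (θ ⁻¹' genSet Z m).indicator 1 := rfl
    rw [this, integral_indicator_one (hθ (measurableSet_genSet m))]
    rfl
  filter_upwards [ae_all_iff.2 this] with s hs
  exact funext hs

/-- The frequencies of the samples are distributed as the laws of a sample. -/
lemma map_frequency_eq {Ω : Type*} [MeasurableSpace Ω] {ω : Measure Ω} {τ : Measure S}
    {π : Measure P} [IsProbabilityMeasure ω] [IsProbabilityMeasure τ] [IsProbabilityMeasure π]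
    {p : ℕ → S → P}
    (hp : ∀ n, MeasurePreserving (p n) τ π) (hi : Pairwise fun m n => IndepFun (p m) (p n) τ)
    {Θ : Ω × P → Z} (hΘ : Measurable Θ) :
    Measurable (fun w m => (π ((fun q => Θ (w, q)) ⁻¹' genSet Z m)).toReal) ∧
    ((ω.prod τ).map (fun w n => Θ (w.1, p n w.2))).map frequency =
      ω.map (fun w m => (π ((fun q => Θ (w, q)) ⁻¹' genSet Z m)).toReal) := by
  have he : Measurable (fun w m => (π ((fun q => Θ (w, q)) ⁻¹' genSet Z m)).toReal) :=
    measurable_pi_lambda _ fun m =>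
      (measurable_measure_prodMk_left (hΘ (measurableSet_genSet m))).ennreal_toReal
  have hs : Measurable (fun (w : Ω × S) n => Θ (w.1, p n w.2)) :=
    measurable_pi_lambda _ fun n =>
      hΘ.comp (measurable_fst.prodMk ((hp n).measurable.comp measurable_snd))
  refine ⟨he, ?_⟩
  -- Almost surely the frequencies depend on the parameter alone, so both laws can be compared on
  -- `ω.prod τ`.
  have hfst : MeasurePreserving Prod.fst (ω.prod τ) ω := measurePreserving_fst
  conv_rhs => rw [← hfst.map_eq, Measure.map_map he measurable_fst]
  rw [Measure.map_map measurable_frequency hs]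
  refine Measure.map_congr ?_
  have hset : MeasurableSet {w : Ω × S | frequency (fun n => Θ (w.1, p n w.2)) =
      fun m => (π ((fun q => Θ (w.1, q)) ⁻¹' genSet Z m)).toReal} :=
    measurableSet_eq_fun (measurable_frequency.comp hs) (he.comp measurable_fst)
  refine (Measure.ae_prod_iff_ae_ae hset).2 (ae_of_all _ fun w => ?_)
  exact ae_frequency_eq hp hi (θ := fun q => Θ (w, q)) (hΘ.comp measurable_prodMk_left)

/-- Generic sets must be measurable in order to have analytic images and to be standard Borel spaces
themselves. -/
lemma exists_measurable_subset_ae {Ω : Type*} [MeasurableSpace Ω] {ω : Measure Ω} {G : Set Ω}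
    (hG : G ∈ ae ω) : ∃ H ⊆ G, MeasurableSet H ∧ ω Hᶜ = 0 :=
  ⟨(toMeasurable ω Gᶜ)ᶜ, compl_subset_comm.1 (subset_toMeasurable _ _),
    (measurableSet_toMeasurable _ _).compl, by
      rw [compl_compl, measure_toMeasurable]
      exact hG⟩

/-- If two sequences of samples, with random parameters, have the same law, then the laws of a
sample agree for some pair of generic values of the parameters. -/
lemma exists_map_eq_of_map_samples_eq {Ω Ω' S' P' : Type*} [MeasurableSpace Ω]
    [MeasurableSpace Ω'] [MeasurableSpace S'] [MeasurableSpace P'] [StandardBorelSpace Ω]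
    [StandardBorelSpace Ω'] {ω : Measure Ω} {ω' : Measure Ω'} {τ : Measure S} {τ' : Measure S'}
    {π : Measure P} {π' : Measure P'} [IsProbabilityMeasure ω] [IsProbabilityMeasure ω']
    [IsProbabilityMeasure τ] [IsProbabilityMeasure τ'] [IsProbabilityMeasure π]
    [IsProbabilityMeasure π'] {p : ℕ → S → P} {p' : ℕ → S' → P'}
    (hp : ∀ n, MeasurePreserving (p n) τ π) (hi : Pairwise fun m n => IndepFun (p m) (p n) τ)
    (hp' : ∀ n, MeasurePreserving (p' n) τ' π')
    (hi' : Pairwise fun m n => IndepFun (p' m) (p' n) τ')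
    {Θ : Ω × P → Z} {Θ' : Ω' × P' → Z} (hΘ : Measurable Θ) (hΘ' : Measurable Θ')
    (hlaw : (ω.prod τ).map (fun w n => Θ (w.1, p n w.2)) =
      (ω'.prod τ').map (fun w n => Θ' (w.1, p' n w.2)))
    {G : Set Ω} {G' : Set Ω'} (hG : G ∈ ae ω) (hG' : G' ∈ ae ω') :
    ∃ w ∈ G, ∃ w' ∈ G', π.map (fun q => Θ (w, q)) = π'.map (fun q => Θ' (w', q)) := by
  obtain ⟨he, hq⟩ := map_frequency_eq (ω := ω) hp hi hΘ
  obtain ⟨he', hq'⟩ := map_frequency_eq (ω := ω') hp' hi' hΘ'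
  set e := fun w m => (π ((fun q => Θ (w, q)) ⁻¹' genSet Z m)).toReal
  set e' := fun w m => (π' ((fun q => Θ' (w, q)) ⁻¹' genSet Z m)).toReal
  have hee : ω.map e = ω'.map e' := by rw [← hq, ← hq', hlaw]
  obtain ⟨H, hHG, hH, hH0⟩ := exists_measurable_subset_ae hG
  obtain ⟨H', hHG', hH', hH0'⟩ := exists_measurable_subset_ae hG'
  by_contra! hne
  -- A common value would make two sample laws agree on a generating pi-system, hence everywhere,
  -- against `hne`.
  have hdisj : Disjoint (e '' H) (e' '' H') := by
    rw [Set.disjoint_left]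
    rintro _ ⟨w, hw, rfl⟩ ⟨w', hw', hww'⟩
    have hθ : Measurable fun q => Θ (w, q) := hΘ.comp measurable_prodMk_left
    have hθ' : Measurable fun q => Θ' (w', q) := hΘ'.comp measurable_prodMk_left
    have := Measure.isProbabilityMeasure_map (μ := π) hθ.aemeasurable
    refine hne w (hHG hw) w' (hHG' hw') (measure_ext_genSet fun m => ?_)
    rw [Measure.map_apply hθ (measurableSet_genSet m), Measure.map_apply hθ' (measurableSet_genSet m)]
    exact ((ENNReal.toReal_eq_toReal_iff' (measure_ne_top _ _) (measure_ne_top _ _)).1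
      (congrFun hww' m)).symm
  -- Lusin separation of disjoint analytic sets: `B` then has mass one for the law of `e` and mass
  -- zero for that of `e'`, although these laws are equal.
  obtain ⟨B, hHB, hBH', hB⟩ :=
    (hH.analyticSet_image he).measurablySeparable (hH'.analyticSet_image he') hdisj
  have h1 : ω.map e Bᶜ = 0 := by
    rw [Measure.map_apply he hB.compl]
    refine measure_mono_null (fun w hw hwH => hw (hHB (mem_image_of_mem e hwH))) hH0
  have h2 : ω'.map e' B = 0 := by
    rw [Measure.map_apply he' hB]
    have hsub : e' ⁻¹' B ⊆ H'ᶜ := fun w hw hwH =>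
      Set.disjoint_left.1 hBH' (mem_image_of_mem e' hwH) hw
    exact measure_mono_null hsub hH0'
  have := Measure.isProbabilityMeasure_map (μ := ω) he.aemeasurable
  have h3 := prob_add_prob_compl (μ := ω.map e) hB
  rw [h1, hee, h2] at h3
  simp at h3

end Samples

/-! ### Recovering points from sampled sections -/

section LeftInverse

variable {X Y : Type*} [MeasurableSpace X] [MeasurableSpace Y]

lemma pairwise_indepFun_eval (ν : Measure Y) [IsProbabilityMeasure ν] :
    Pairwise fun m n : ℕ => IndepFun (fun y : ℕ → Y => y m) (fun y => y n) (bernoulliMeasure ν) :=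
  fun _ _ hmn => (iIndepFun_infinitePi (P := fun _ : ℕ => ν) (X := fun _ y => y)
    fun _ => measurable_id).indepFun hmn

variable [MeasurableSpace.CountablyGenerated Y]

/-- An estimate of the code of a section from its values `u j` at the sample points `y j`. -/
def sampleCode (y : ℕ → Y) (u : ℕ → ℝ) (m : ℕ) : ℝ≥0∞ :=
  ENNReal.ofReal (limsup (fun n : ℕ => (∑ j ∈ Finset.range n,
    (genSet Y m).indicator (1 : Y → ℝ) (y j) * (squash (u j)).toReal) / n) atTop)

lemma measurable_sampleCode {W : Type*} [MeasurableSpace W] {y : W → ℕ → Y} {u : W → ℕ → ℝ}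
    (hy : Measurable y) (hu : Measurable u) : Measurable fun w => sampleCode (y w) (u w) := by
  refine measurable_pi_lambda _ fun m => (Measurable.limsup fun n => ?_).ennreal_ofReal
  refine (Finset.measurable_sum _ fun j _ => Measurable.mul ?_ ?_).div_const _
  · exact (measurable_indicator_genSet m).comp
      ((measurable_pi_apply j).comp hy)
  · exact (measurable_squash.comp ((measurable_pi_apply j).comp hu)).ennreal_toReal

/-- The strong law for the squashed values of `φ` cut off by a generating set; the summands are
bounded by `π`. -/
lemma ae_sampleCode_eq (ν : Measure Y) [IsProbabilityMeasure ν] {φ : Y → ℝ} (hφ : Measurable φ) :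
    ∀ᵐ y ∂bernoulliMeasure ν, sampleCode y (fun j => φ (y j)) =
      fun m => ∫⁻ z in genSet Y m, squash (φ z) ∂ν := by
  have hs : Measurable fun z => squash (φ z) := measurable_squash.comp hφ
  have : ∀ m, ∀ᵐ y ∂bernoulliMeasure ν, sampleCode y (fun j => φ (y j)) m =
      ∫⁻ z in genSet Y m, squash (φ z) ∂ν := by
    intro m
    have h := tendsto_average_of_indepFun
      (fun n => measurePreserving_eval_infinitePi (fun _ : ℕ => ν) n) (pairwise_indepFun_eval ν)
      ((measurable_indicator_genSet m).mul hs.ennreal_toReal) (C := Real.pi) fun z => by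
        have h1 : (squash (φ z)).toReal ≤ Real.pi :=
          ENNReal.toReal_le_of_le_ofReal Real.pi_pos.le (squash_le _)
        by_cases hz : z ∈ genSet Y m <;> simp [hz, h1, Real.pi_pos.le]
    filter_upwards [h] with y hy
    have hlim : limsup (fun n : ℕ => (∑ j ∈ Finset.range n,
        (genSet Y m).indicator (1 : Y → ℝ) (y j) * (squash (φ (y j))).toReal) / n) atTop =
        ∫ z, (genSet Y m).indicator (1 : Y → ℝ) z * (squash (φ z)).toReal ∂ν :=
      Tendsto.limsup_eq hy
    have hind : ∀ z, (genSet Y m).indicator (1 : Y → ℝ) z * (squash (φ z)).toReal =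
        (genSet Y m).indicator (fun z => (squash (φ z)).toReal) z := fun z => by
      by_cases hz : z ∈ genSet Y m <;> simp [hz]
    simp_rw [hind] at hlim
    rw [integral_indicator (measurableSet_genSet m), integral_toReal hs.aemeasurable
      (ae_of_all _ fun z => (squash_ne_top _).lt_top)] at hlim
    have hfin : ∫⁻ z in genSet Y m, squash (φ z) ∂ν ≠ ∞ := by
      refine ((lintegral_mono fun z => squash_le _).trans_lt ?_).ne
      rw [lintegral_const]
      exact ENNReal.mul_lt_top ENNReal.ofReal_lt_top (measure_lt_top _ _)
    unfold sampleCode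
    simp_rw [hind]
    rw [hlim, ENNReal.ofReal_toReal hfin]
  filter_upwards [ae_all_iff.2 this] with y hy
  exact funext hy

/-- If almost all points are determined by their sections, then they are determined, mod 0, by
the values of their sections at random points. -/
lemma ae_exists_leftInverse [StandardBorelSpace X] {μ : Measure X} {ν : Measure Y}
    [IsProbabilityMeasure μ] [IsProbabilityMeasure ν] {f : X → Y → ℝ}
    (hf : Measurable fun p : X × Y => f p.1 p.2)
    (hpure : ∃ s ∈ ae μ, ∀ x ∈ s, ∀ x' ∈ s, (∀ᵐ y ∂ν, f x y = f x' y) → x = x') :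
    ∀ᵐ y ∂bernoulliMeasure ν, ∃ R : (ℕ → ℝ) → X, Measurable R ∧
      ∀ᵐ x ∂μ, R (fun j => f x (y j)) = x := by
  obtain ⟨s, hs, hinj⟩ := hpure
  obtain ⟨H, hHs, hH, hH0⟩ := exists_measurable_subset_ae hs
  have hfx : ∀ x, Measurable (f x) := fun x => hf.comp measurable_prodMk_left
  have hΦ : Measurable (code ν f) := measurable_code hf
  have : StandardBorelSpace H := hH.standardBorel
  have hX : Nonempty X := nonempty_of_isProbabilityMeasure μ
  -- Equal codes give a.e. equal sections, hence equal points of `H` by purity. By Lusin–Souslin the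
  -- injective map `code` has a measurable inverse on its image, extended below to all codes.
  have hemb : MeasurableEmbedding fun x : H => code ν f x :=
    (hΦ.comp measurable_subtype_coe).measurableEmbedding fun x x' hxx' =>
      Subtype.ext (hinj x (hHs x.2) x' (hHs x'.2) (ae_eq_of_code_eq hfx hxx'))
  obtain ⟨inv, hinv, hinvH⟩ := hemb.exists_measurable_extend measurable_subtype_coe fun _ => hX
  have hset : MeasurableSet {p : X × (ℕ → Y) |
      sampleCode p.2 (fun j => f p.1 (p.2 j)) = code ν f p.1} := by
    have hg : Measurable fun (p : X × (ℕ → Y)) j => f p.1 (p.2 j) :=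
      measurable_pi_lambda _ fun j =>
        hf.comp (measurable_fst.prodMk ((measurable_pi_apply j).comp measurable_snd))
    have hg' := measurable_sampleCode measurable_snd hg
    exact measurableSet_eq_fun hg' (hΦ.comp measurable_fst)
  -- The strong law holds for each `x` and a.e. sample; by Fubini a.e. single sample serves almost
  -- all `x`.
  have hcode : ∀ᵐ y ∂bernoulliMeasure ν, ∀ᵐ x ∂μ,
      sampleCode y (fun j => f x (y j)) = code ν f x :=
    (Measure.ae_ae_comm hset).1 (ae_of_all _ fun x => ae_sampleCode_eq ν (hfx x))
  filter_upwards [hcode] with y hy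
  refine ⟨fun u => inv (sampleCode y u),
    hinv.comp (measurable_sampleCode measurable_const measurable_id), ?_⟩
  filter_upwards [hy, show H ∈ ae μ from hH0] with x hx hxH
  rw [hx]
  exact congrFun hinvH ⟨x, hxH⟩

end LeftInverse

/-! ### Isomorphisms from equal laws -/

section Iso

lemma measurePreserving_comp_leftInverse {X Y : Type*} [MeasurableSpace X] [MeasurableSpace Y]
    {μ : Measure X} {ν : Measure Y} {J : X → ℕ → ℝ} {J' : Y → ℕ → ℝ} {R' : (ℕ → ℝ) → Y}
    (hJ : Measurable J) (hJ' : Measurable J') (hR' : Measurable R')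
    (hRJ' : ∀ᵐ y ∂ν, R' (J' y) = y) (h : μ.map J = ν.map J') :
    MeasurePreserving (fun x => R' (J x)) μ ν := by
  refine ⟨hR'.comp hJ, ?_⟩
  rw [← Function.comp_def, ← Measure.map_map hR' hJ, h, Measure.map_map hR' hJ',
    Measure.map_congr (f := R' ∘ J') (g := id) hRJ', Measure.map_id]

/-- `J' ∘ R'` is the identity a.e. for the law of `J'`, which is also the law of `J`; so only `R (J
x)` remains. -/
lemma ae_comp_leftInverse_eq {X Y : Type*} [MeasurableSpace X] [MeasurableSpace Y]
    {μ : Measure X} {ν : Measure Y} {J : X → ℕ → ℝ} {J' : Y → ℕ → ℝ} {R : (ℕ → ℝ) → X}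
    {R' : (ℕ → ℝ) → Y} (hJ : Measurable J) (hJ' : Measurable J') (hR' : Measurable R')
    (hRJ : ∀ᵐ x ∂μ, R (J x) = x) (hRJ' : ∀ᵐ y ∂ν, R' (J' y) = y) (h : μ.map J = ν.map J') :
    ∀ᵐ x ∂μ, R (J' (R' (J x))) = x := by
  have hu : ∀ᵐ u ∂(μ.map J), J' (R' u) = u := by
    have hset : MeasurableSet {u | J' (R' u) = u} :=
      measurableSet_eq_fun (hJ'.comp hR') measurable_id
    rw [h, ae_map_iff hJ'.aemeasurable hset]
    filter_upwards [hRJ'] with y hy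
    rw [hy]
  filter_upwards [ae_of_ae_map hJ.aemeasurable hu, hRJ] with x h1 h2
  rw [h1, h2]

lemma isModZeroIso_of_map_eq {X Y : Type*} [MeasurableSpace X] [MeasurableSpace Y]
    {μ : Measure X} {ν : Measure Y} {J : X → ℕ → ℝ} {J' : Y → ℕ → ℝ} {R : (ℕ → ℝ) → X}
    {R' : (ℕ → ℝ) → Y} (hJ : Measurable J) (hJ' : Measurable J') (hR : Measurable R)
    (hR' : Measurable R') (hRJ : ∀ᵐ x ∂μ, R (J x) = x) (hRJ' : ∀ᵐ y ∂ν, R' (J' y) = y)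
    (h : μ.map J = ν.map J') : IsModZeroIso μ ν fun x => R' (J x) :=
  ⟨measurePreserving_comp_leftInverse hJ hJ' hR' hRJ' h, fun y => R (J' y),
    measurePreserving_comp_leftInverse hJ' hJ hR hRJ h.symm,
    ae_comp_leftInverse_eq hJ hJ' hR' hRJ hRJ' h,
    ae_comp_leftInverse_eq hJ' hJ hR hRJ' hRJ h.symm⟩

variable {X₁ X₂ Y₁ Y₂ : Type*} [MeasurableSpace X₁] [MeasurableSpace X₂] [MeasurableSpace Y₁]
  [MeasurableSpace Y₂]

/-- The values of the sections of `f` along two sequences of sample points, and the value of `f`. -/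
def sampleMap (f : X₁ → X₂ → ℝ) (a : ℕ → X₁) (a' : ℕ → X₂) (p : X₁ × X₂) :
    (ℕ → ℝ) × (ℕ → ℝ) × ℝ :=
  (fun j => f p.1 (a' j), fun i => f (a i) p.2, f p.1 p.2)

lemma measurable_sampleMap {f : X₁ → X₂ → ℝ} (hf : Measurable fun p : X₁ × X₂ => f p.1 p.2) :
    Measurable fun q : ((ℕ → X₁) × (ℕ → X₂)) × (X₁ × X₂) => sampleMap f q.1.1 q.1.2 q.2 := by
  refine (measurable_pi_lambda _ fun j => ?_).prodMk
    ((measurable_pi_lambda _ fun i => ?_).prodMk (hf.comp measurable_snd))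
  · have h : Measurable fun q : ((ℕ → X₁) × (ℕ → X₂)) × (X₁ × X₂) => (q.2.1, q.1.2 j) := by
      fun_prop
    exact hf.comp h
  · have h : Measurable fun q : ((ℕ → X₁) × (ℕ → X₂)) × (X₁ × X₂) => (q.1.1 i, q.2.2) := by
      fun_prop
    exact hf.comp h

variable {μ₁ : Measure X₁} {μ₂ : Measure X₂} {ν₁ : Measure Y₁} {ν₂ : Measure Y₂}
  [IsProbabilityMeasure μ₁] [IsProbabilityMeasure μ₂] [IsProbabilityMeasure ν₁]
  [IsProbabilityMeasure ν₂] {f : X₁ → X₂ → ℝ} {g : Y₁ → Y₂ → ℝ}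

lemma map_fst_sampleMap (hf : Measurable fun p : X₁ × X₂ => f p.1 p.2) (a : ℕ → X₁)
    (a' : ℕ → X₂) :
    ((μ₁.prod μ₂).map (sampleMap f a a')).map Prod.fst = μ₁.map (fun x j => f x (a' j)) ∧
    ((μ₁.prod μ₂).map (sampleMap f a a')).map (fun z => z.2.1) =
      μ₂.map (fun x i => f (a i) x) := by
  have hF : Measurable (sampleMap f a a') :=
    (measurable_sampleMap hf).comp (measurable_prodMk_left (x := (a, a')))
  have h1 : MeasurePreserving Prod.fst (μ₁.prod μ₂) μ₁ := measurePreserving_fst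
  have h2 : MeasurePreserving Prod.snd (μ₁.prod μ₂) μ₂ := measurePreserving_snd
  have hJ : Measurable fun x j => f x (a' j) :=
    measurable_pi_lambda _ fun j => hf.comp measurable_prodMk_right
  have hK : Measurable fun x i => f (a i) x :=
    measurable_pi_lambda _ fun i => hf.comp measurable_prodMk_left
  constructor
  · conv_rhs => rw [← h1.map_eq, Measure.map_map hJ measurable_fst]
    rw [Measure.map_map measurable_fst hF]
    rfl
  · conv_rhs => rw [← h2.map_eq, Measure.map_map hK measurable_snd]
    rw [Measure.map_map (by fun_prop) hF]
    rfl

/-- Equal laws of the values of the sections along samples give equal marginals, and a relation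
between the functions. -/
lemma marginals_of_map_sampleMap_eq (hf : Measurable fun p : X₁ × X₂ => f p.1 p.2)
    (hg : Measurable fun p : Y₁ × Y₂ => g p.1 p.2) {a : ℕ → X₁} {a' : ℕ → X₂} {c : ℕ → Y₁}
    {c' : ℕ → Y₂} {R₁ : (ℕ → ℝ) → Y₁} {R₂ : (ℕ → ℝ) → Y₂} (hR₁ : Measurable R₁)
    (hR₂ : Measurable R₂) (hRc' : ∀ᵐ y ∂ν₁, R₁ (fun j => g y (c' j)) = y)
    (hRc : ∀ᵐ y ∂ν₂, R₂ (fun i => g (c i) y) = y)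
    (h : (μ₁.prod μ₂).map (sampleMap f a a') = (ν₁.prod ν₂).map (sampleMap g c c')) :
    μ₁.map (fun x j => f x (a' j)) = ν₁.map (fun y j => g y (c' j)) ∧
    μ₂.map (fun x i => f (a i) x) = ν₂.map (fun y i => g (c i) y) ∧
    ∀ᵐ p ∂(μ₁.prod μ₂), g (R₁ fun j => f p.1 (a' j)) (R₂ fun i => f (a i) p.2) = f p.1 p.2 := by
  have hF : Measurable (sampleMap f a a') :=
    (measurable_sampleMap hf).comp (measurable_prodMk_left (x := (a, a')))
  have hG : Measurable (sampleMap g c c') :=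
    (measurable_sampleMap hg).comp (measurable_prodMk_left (x := (c, c')))
  have h₁ := map_fst_sampleMap (μ₁ := μ₁) (μ₂ := μ₂) hf a a'
  have h₂ := map_fst_sampleMap (μ₁ := ν₁) (μ₂ := ν₂) hg c c'
  rw [h, h₂.1, h₂.2] at h₁
  refine ⟨h₁.1.symm, h₁.2.symm, ?_⟩
  · have hset : MeasurableSet {z : (ℕ → ℝ) × (ℕ → ℝ) × ℝ | g (R₁ z.1) (R₂ z.2.1) = z.2.2} := by
      have h1 : Measurable fun z : (ℕ → ℝ) × (ℕ → ℝ) × ℝ => (R₁ z.1, R₂ z.2.1) := by fun_prop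
      have h2 : Measurable fun z : (ℕ → ℝ) × (ℕ → ℝ) × ℝ => g (R₁ z.1) (R₂ z.2.1) := hg.comp h1
      exact measurableSet_eq_fun h2 (by fun_prop)
    -- For triples sampled from `g` the relation holds because `R₁` and `R₂` return the two points.
    -- It is a property of the law of the triple, so it passes to triples sampled from `f`.
    have hz : ∀ᵐ z ∂((μ₁.prod μ₂).map (sampleMap f a a')), g (R₁ z.1) (R₂ z.2.1) = z.2.2 := by
      rw [h, ae_map_iff hG.aemeasurable hset]
      filter_upwards [Measure.quasiMeasurePreserving_fst.ae hRc',
        Measure.quasiMeasurePreserving_snd.ae hRc] with p h1 h2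
      simp only [sampleMap]
      rw [h1, h2]
    exact ae_of_ae_map hF.aemeasurable hz

end Iso

/-! ### Samples in a random matrix -/

section Sampling

lemma measurePreserving_prodProdProdComm {A B C D : Type*} [MeasurableSpace A]
    [MeasurableSpace B] [MeasurableSpace C] [MeasurableSpace D] (α : Measure A) (β : Measure B)
    (γ : Measure C) (δ : Measure D) [IsProbabilityMeasure α] [IsProbabilityMeasure β]
    [IsProbabilityMeasure γ] [IsProbabilityMeasure δ] :
    MeasurePreserving (fun w : (A × B) × (C × D) => ((w.1.1, w.2.1), (w.1.2, w.2.2)))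
      ((α.prod β).prod (γ.prod δ)) ((α.prod γ).prod (β.prod δ)) := by
  have h1 := measurePreserving_prodAssoc α β (γ.prod δ)
  have h2 := (measurePreserving_prodAssoc β γ δ).symm
  have h3 := (Measure.measurePreserving_swap (μ := β) (ν := γ)).prod (MeasurePreserving.id δ)
  have h4 := measurePreserving_prodAssoc γ β δ
  have h5 := (MeasurePreserving.id α).prod ((h4.comp h3).comp h2)
  have h6 := (measurePreserving_prodAssoc α γ (β.prod δ)).symm
  exact (h6.comp h5).comp h1

variable {X Y : Type*} [MeasurableSpace X] [MeasurableSpace Y] (μ : Measure X) (ν : Measure Y)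
  [IsProbabilityMeasure μ] [IsProbabilityMeasure ν]

lemma pairwise_indepFun_eval_prod :
    Pairwise fun m n : ℕ => IndepFun (fun w : (ℕ → X) × (ℕ → Y) => (w.1 m, w.2 m))
      (fun w => (w.1 n, w.2 n)) ((bernoulliMeasure μ).prod (bernoulliMeasure ν)) := by
  intro m n hmn
  rw [indepFun_iff_map_prod_eq_prod_map_map (by fun_prop) (by fun_prop),
    (measurePreserving_eval_prod μ ν m m).map_eq, (measurePreserving_eval_prod μ ν n n).map_eq]
  exact ((measurePreserving_prodProdProdComm μ μ ν ν).comp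
    ((measurePreserving_eval_pair μ hmn).prod (measurePreserving_eval_pair ν hmn))).map_eq

/-- Different `n` use disjoint pairs of coordinates. -/
lemma pairwise_indepFun_eval_pair :
    Pairwise fun m n : ℕ => IndepFun (fun x : ℕ → X => (x (evenIdx m), x (oddIdx m)))
      (fun x => (x (evenIdx n), x (oddIdx n))) (bernoulliMeasure μ) := by
  intro m n hmn
  exact (iIndepFun_infinitePi (P := fun _ : ℕ => μ) (X := fun _ x => x)
    fun _ => measurable_id).indepFun_prodMk_prodMk (fun i => measurable_pi_apply i) _ _ _ _
    (evenIdx_injective.ne hmn) (evenIdx_ne_oddIdx _ _) (evenIdx_ne_oddIdx _ _).symm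
    (oddIdx_injective.ne hmn)

/-- Even rows and columns serve as sample points for the odd rows and columns. -/
def rowColSamples (A : InfMatrix) (n : ℕ) : (ℕ → ℝ) × (ℕ → ℝ) × ℝ :=
  (fun j => A (oddIdx n) (evenIdx j), fun i => A (evenIdx i) (oddIdx n), A (oddIdx n) (oddIdx n))

lemma measurable_rowColSamples : Measurable rowColSamples := by
  unfold rowColSamples
  fun_prop

/-- Interleaving the parameters `w.1` with the samples `w.2` gives again an i.i.d. grid. Hence the
law of the samples depends only on the matrix distribution. -/
lemma map_rowColSamples {f : X → Y → ℝ} (hf : Measurable fun p : X × Y => f p.1 p.2) :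
    (((bernoulliMeasure μ).prod (bernoulliMeasure ν)).prod
      ((bernoulliMeasure μ).prod (bernoulliMeasure ν))).map
        (fun w n => sampleMap f w.1.1 w.1.2 (w.2.1 n, w.2.2 n)) =
      (matrixDistribution μ ν f).map rowColSamples := by
  have h := ((measurePreserving_interleave μ).prod (measurePreserving_interleave ν)).comp
    (measurePreserving_prodProdProdComm (bernoulliMeasure μ) (bernoulliMeasure ν)
      (bernoulliMeasure μ) (bernoulliMeasure ν))
  unfold matrixDistribution
  rw [Measure.map_map measurable_rowColSamples (measurable_grid hf)]
  conv_rhs => rw [← h.map_eq,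
    Measure.map_map (measurable_rowColSamples.comp (measurable_grid hf)) h.measurable]
  congr 1
  funext w n
  simp [sampleMap, rowColSamples]

/-- Even rows and columns serve as sample points for pairs of a row and a column with distinct odd
indices; the diagonal is avoided. -/
def offDiagSamples (A : {p : ℕ × ℕ // p.1 ≠ p.2} → ℝ) (n : ℕ) : (ℕ → ℝ) × (ℕ → ℝ) × ℝ :=
  (fun j => A ⟨(oddIdx (evenIdx n), evenIdx j), (evenIdx_ne_oddIdx _ _).symm⟩,
    fun i => A ⟨(evenIdx i, oddIdx (oddIdx n)), evenIdx_ne_oddIdx _ _⟩,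
    A ⟨(oddIdx (evenIdx n), oddIdx (oddIdx n)), oddIdx_injective.ne (evenIdx_ne_oddIdx _ _)⟩)

lemma measurable_offDiagSamples : Measurable offDiagSamples := by
  unfold offDiagSamples
  fun_prop

/-- A single sequence `w.1` provides the parameters for rows and columns alike; this is what leads
to one transformation for both variables. -/
lemma map_offDiagSamples {f : X → X → ℝ} (hf : Measurable fun p : X × X => f p.1 p.2) :
    ((bernoulliMeasure μ).prod (bernoulliMeasure μ)).map
        (fun w n => sampleMap f w.1 w.1 (w.2 (evenIdx n), w.2 (oddIdx n))) =
      ((symmMatrixDistribution μ f).map offDiagPart).map offDiagSamples := by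
  have h := measurePreserving_interleave μ
  unfold symmMatrixDistribution
  rw [Measure.map_map measurable_offDiagPart (measurable_symmGrid hf),
    Measure.map_map measurable_offDiagSamples
      (measurable_offDiagPart.comp (measurable_symmGrid hf))]
  conv_rhs => rw [← h.map_eq, Measure.map_map (measurable_offDiagSamples.comp
      (measurable_offDiagPart.comp (measurable_symmGrid hf))) h.measurable]
  congr 1
  funext w n
  simp [sampleMap, offDiagSamples, offDiagPart]

end Sampling

/-! ### Uniqueness of pure functions -/

section Uniqueness

/-- Pure functions with equal matrix distributions are isomorphic. -/
lemma funIso_of_matrixDistribution_eq {X₁ X₂ Y₁ Y₂ : Type*}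
    [MeasurableSpace X₁] [MeasurableSpace X₂] [MeasurableSpace Y₁] [MeasurableSpace Y₂]
    [StandardBorelSpace X₁] [StandardBorelSpace X₂] [StandardBorelSpace Y₁] [StandardBorelSpace Y₂]
    {μ₁ : Measure X₁} {μ₂ : Measure X₂} {ν₁ : Measure Y₁} {ν₂ : Measure Y₂}
    [IsProbabilityMeasure μ₁] [IsProbabilityMeasure μ₂]
    [IsProbabilityMeasure ν₁] [IsProbabilityMeasure ν₂] {f : X₁ → X₂ → ℝ} {g : Y₁ → Y₂ → ℝ}
    (hf : Measurable fun p : X₁ × X₂ => f p.1 p.2) (hg : Measurable fun p : Y₁ × Y₂ => g p.1 p.2)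
    (hfp : IsPure μ₁ μ₂ f) (hgp : IsPure ν₁ ν₂ g)
    (h : matrixDistribution μ₁ μ₂ f = matrixDistribution ν₁ ν₂ g) :
    FunIso μ₁ μ₂ f ν₁ ν₂ g := by
  -- Points of the first space are recovered from the sampled columns, whence the second projection;
  -- points of the second space from the sampled rows.
  have hf1 := Measure.quasiMeasurePreserving_snd (μ := bernoulliMeasure μ₁).ae
    (ae_exists_leftInverse hf hfp.1)
  have hf2 := Measure.quasiMeasurePreserving_fst (ν := bernoulliMeasure μ₂).ae
    (ae_exists_leftInverse (f := fun y x => f x y) (hf.comp measurable_swap) hfp.2)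
  have hg1 := Measure.quasiMeasurePreserving_snd (μ := bernoulliMeasure ν₁).ae
    (ae_exists_leftInverse hg hgp.1)
  have hg2 := Measure.quasiMeasurePreserving_fst (ν := bernoulliMeasure ν₂).ae
    (ae_exists_leftInverse (f := fun y x => g x y) (hg.comp measurable_swap) hgp.2)
  obtain ⟨⟨a, a'⟩, ⟨⟨R₁, hR₁, hRf₁⟩, ⟨R₂, hR₂, hRf₂⟩⟩, ⟨c, c'⟩, ⟨⟨S₁, hS₁, hSg₁⟩, ⟨S₂, hS₂, hSg₂⟩⟩,
      hac⟩ := exists_map_eq_of_map_samples_eq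
    (fun n => measurePreserving_eval_prod μ₁ μ₂ n n) (pairwise_indepFun_eval_prod μ₁ μ₂)
    (fun n => measurePreserving_eval_prod ν₁ ν₂ n n) (pairwise_indepFun_eval_prod ν₁ ν₂)
    (measurable_sampleMap hf) (measurable_sampleMap hg)
    ((map_rowColSamples μ₁ μ₂ hf).trans ((congrArg _ h).trans (map_rowColSamples ν₁ ν₂ hg).symm))
    (hf1.and hf2) (hg1.and hg2)
  obtain ⟨h1, h2, h3⟩ := marginals_of_map_sampleMap_eq hf hg hS₁ hS₂ hSg₁ hSg₂ hac
  exact ⟨_, _,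
    isModZeroIso_of_map_eq (measurable_pi_lambda _ fun j => hf.comp measurable_prodMk_right)
      (measurable_pi_lambda _ fun j => hg.comp measurable_prodMk_right) hR₁ hS₁ hRf₁ hSg₁ h1,
    isModZeroIso_of_map_eq (measurable_pi_lambda _ fun i => hf.comp measurable_prodMk_left)
      (measurable_pi_lambda _ fun i => hg.comp measurable_prodMk_left) hR₂ hS₂ hRf₂ hSg₂ h2, h3⟩

/-- Pure symmetric functions whose symmetric matrix distributions agree off the diagonal are
isomorphic. -/
lemma symmFunIso_of_map_offDiagPart_eq {X Y : Type*} [MeasurableSpace X] [MeasurableSpace Y]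
    [StandardBorelSpace X] [StandardBorelSpace Y] {μ : Measure X} {ν : Measure Y}
    [IsProbabilityMeasure μ] [IsProbabilityMeasure ν] {f : X → X → ℝ} {g : Y → Y → ℝ}
    (hf : Measurable fun p : X × X => f p.1 p.2) (hg : Measurable fun p : Y × Y => g p.1 p.2)
    (hfs : ∀ x y, f x y = f y x) (hgs : ∀ x y, g x y = g y x)
    (hfp : IsPure μ μ f) (hgp : IsPure ν ν g)
    (h : (symmMatrixDistribution μ f).map offDiagPart =
      (symmMatrixDistribution ν g).map offDiagPart) :
    SymmFunIso μ f ν g := by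
  have hX : Measurable fun q : (ℕ → X) × (X × X) => ((q.1, q.1), q.2) := by fun_prop
  have hY : Measurable fun q : (ℕ → Y) × (Y × Y) => ((q.1, q.1), q.2) := by fun_prop
  have hΘ : Measurable fun q : (ℕ → X) × (X × X) => sampleMap f q.1 q.1 q.2 :=
    (measurable_sampleMap hf).comp hX
  have hΘ' : Measurable fun q : (ℕ → Y) × (Y × Y) => sampleMap g q.1 q.1 q.2 :=
    (measurable_sampleMap hg).comp hY
  obtain ⟨a, ⟨R, hR, hRf⟩, c, ⟨S, hS, hSg⟩, hac⟩ := exists_map_eq_of_map_samples_eq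
    (fun n => measurePreserving_eval_pair μ (evenIdx_ne_oddIdx n n)) (pairwise_indepFun_eval_pair μ)
    (fun n => measurePreserving_eval_pair ν (evenIdx_ne_oddIdx n n)) (pairwise_indepFun_eval_pair ν)
    hΘ hΘ'
    ((map_offDiagSamples μ hf).trans ((congrArg _ h).trans (map_offDiagSamples ν hg).symm))
    (ae_exists_leftInverse hf hfp.1) (ae_exists_leftInverse hg hgp.1)
  -- By symmetry `S` inverts the sampled sections in either variable, so both points are moved by
  -- the same map.
  have hSg' : ∀ᵐ y ∂ν, S (fun i => g (c i) y) = y := by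
    simpa only [hgs] using hSg
  obtain ⟨h1, -, h3⟩ := marginals_of_map_sampleMap_eq hf hg hS hS hSg hSg' hac
  refine ⟨fun x => S fun j => f x (a j), isModZeroIso_of_map_eq
    (measurable_pi_lambda _ fun j => hf.comp measurable_prodMk_right)
    (measurable_pi_lambda _ fun j => hg.comp measurable_prodMk_right) hR hS hRf hSg h1, ?_⟩
  filter_upwards [h3] with p hp
  simpa only [hfs p.2] using hp

end Uniqueness

end

/-! ### Existence, purification and uniqueness combined -/

theorem mainTheorem4 :
    -- all permutations of rows and columns
    (∀ M : Measure InfMatrix, IsAldousZeroLambda M →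
      (∃ f : I → I → ℝ, Measurable (fun p : I × I => f p.1 p.2) ∧
        matrixDistribution volume volume f = M) ∧
      (∃ (X₁ X₂ : Type) (_ : MeasurableSpace X₁) (_ : MeasurableSpace X₂)
        (_ : StandardBorelSpace X₁) (_ : StandardBorelSpace X₂)
        (μ₁ : Measure X₁) (μ₂ : Measure X₂) (f : X₁ → X₂ → ℝ),
        IsProbabilityMeasure μ₁ ∧ IsProbabilityMeasure μ₂ ∧
        Measurable (fun p : X₁ × X₂ => f p.1 p.2) ∧ IsPure μ₁ μ₂ f ∧
        matrixDistribution μ₁ μ₂ f = M) ∧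
      (∀ (X₁ : Type u₁) (X₂ : Type u₂) (Y₁ : Type v₁) (Y₂ : Type v₂)
        [MeasurableSpace X₁] [MeasurableSpace X₂] [MeasurableSpace Y₁] [MeasurableSpace Y₂]
        [StandardBorelSpace X₁] [StandardBorelSpace X₂]
        [StandardBorelSpace Y₁] [StandardBorelSpace Y₂]
        (μ₁ : Measure X₁) (μ₂ : Measure X₂) (ν₁ : Measure Y₁) (ν₂ : Measure Y₂)
        [IsProbabilityMeasure μ₁] [IsProbabilityMeasure μ₂]
        [IsProbabilityMeasure ν₁] [IsProbabilityMeasure ν₂]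
        (f : X₁ → X₂ → ℝ) (g : Y₁ → Y₂ → ℝ),
        Measurable (fun p : X₁ × X₂ => f p.1 p.2) → Measurable (fun p : Y₁ × Y₂ => g p.1 p.2) →
        IsPure μ₁ μ₂ f → IsPure ν₁ ν₂ g → matrixDistribution μ₁ μ₂ f = M →
        (matrixDistribution ν₁ ν₂ g = M ↔ FunIso μ₁ μ₂ f ν₁ ν₂ g))) ∧
    -- symmetric matrices, simultaneous permutations of rows and columns
    (∀ M : Measure InfMatrix, IsSymmAldousZeroLambda M →
      (∃ f : I → I → ℝ, Measurable (fun p : I × I => f p.1 p.2) ∧ (∀ x y, f x y = f y x) ∧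
        symmMatrixDistribution volume f = M) ∧
      (∃ (X : Type) (_ : MeasurableSpace X) (_ : StandardBorelSpace X)
        (μ : Measure X) (f : X → X → ℝ),
        IsProbabilityMeasure μ ∧ Measurable (fun p : X × X => f p.1 p.2) ∧
        (∀ x y, f x y = f y x) ∧ IsPure μ μ f ∧
        (symmMatrixDistribution μ f).map offDiagPart = M.map offDiagPart) ∧
      (∀ (X : Type u₁) (Y : Type v₁) [MeasurableSpace X] [MeasurableSpace Y]
        [StandardBorelSpace X] [StandardBorelSpace Y] (μ : Measure X) (ν : Measure Y)
        [IsProbabilityMeasure μ] [IsProbabilityMeasure ν] (f : X → X → ℝ) (g : Y → Y → ℝ),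
        Measurable (fun p : X × X => f p.1 p.2) → Measurable (fun p : Y × Y => g p.1 p.2) →
        (∀ x y, f x y = f y x) → (∀ x y, g x y = g y x) →
        IsPure μ μ f → IsPure ν ν g →
        (symmMatrixDistribution μ f).map offDiagPart = M.map offDiagPart →
        ((symmMatrixDistribution ν g).map offDiagPart = M.map offDiagPart ↔
          SymmFunIso μ f ν g))) := by
  refine ⟨fun M hM => ⟨hM.exists_matrixDistribution_eq, ?_, ?_⟩,
    fun M hM => ⟨hM.exists_symmMatrixDistribution_eq, ?_, ?_⟩⟩
  · obtain ⟨f, hf, rfl⟩ := hM.exists_matrixDistribution_eq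
    obtain ⟨μ₁, μ₂, g, h1, h2, hg, hp, h⟩ := exists_isPure_matrixDistribution_eq volume volume hf
    exact ⟨_, _, _, _, inferInstance, inferInstance, μ₁, μ₂, g, h1, h2, hg, hp, h⟩
  · rintro X₁ X₂ Y₁ Y₂ _ _ _ _ _ _ _ _ μ₁ μ₂ ν₁ ν₂ _ _ _ _ f g hf hg hfp hgp rfl
    refine ⟨fun h => funIso_of_matrixDistribution_eq hf hg hfp hgp h.symm, ?_⟩
    rintro ⟨T₁, T₂, hT₁, hT₂, h⟩
    exact matrixDistribution_eq_of_ae_eq hg hT₁.1 hT₂.1 h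
  · obtain ⟨f, hf, hs, rfl⟩ := hM.exists_symmMatrixDistribution_eq
    obtain ⟨μ₁, g, h1, hg, hgs, hp, h⟩ := exists_isPure_symmMatrixDistribution_eq volume hf hs
    exact ⟨_, _, inferInstance, μ₁, g, h1, hg, hgs, hp, h⟩
  · intro X Y _ _ _ _ μ ν _ _ f g hf hg hfs hgs hfp hgp hfM
    rw [← hfM]
    refine ⟨fun h => symmFunIso_of_map_offDiagPart_eq hf hg hfs hgs hfp hgp h.symm, ?_⟩
    rintro ⟨T, hT, h⟩
    exact map_offDiagPart_eq_of_ae_eq hf hg hT.1 h
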